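/- Let $\mathcal X$ be a finite non-empty state space, $\mathcal L(\mathcal X)$ the set of real functions on $\mathcal X$ with the supremum norm, and $\Omega$ a set of paths $\omega:\mathbb R_{\ge0}\to\mathcal X$ such that for every non-empty finite set $u\subset\mathbb R_{\ge0}$ and every $x_u\in\mathcal X_u:=\mathcal X^u$ some $\omega\in\Omega$ satisfies $\omega|_u=x_u$. Let $\mathcal U$ be the set of all finite (possibly empty) $u\subset\mathbb R_{\ge0}$, and write $u<t$ if $r<t$ for all $r\in u$. Put $(X_t=x):=\{\omega\in\Omega:\omega(t)=x\}$ and $(X_u=x_u):=\{\omega\in\Omega:\omega|_u=x_u\}$. **Processes.** A stochastic process $P$ is a real-valued map on the set of all pairs $(A,X_u=x_u)$, where $u\in\mathcal U$, $x_u\in\mathcal X_u$ and $A$ belongs to the algebra generated by the events $(X_t=x)$ with $x\in\mathcal X$ and $t\in u$ or $t>u$, that is coherent: for all $n\ge1$, all pairs $(A_i,C_i)$ in the domain and all $\lambda_i\in\mathbb R$, $1\le i\le n$, $$\max\Big\{\sum_{i=1}^n\lambda_i\mathbb I_{C_i}(\omega)\big(P(A_i|C_i)-\mathbb I_{A_i}(\omega)\big):\omega\in\bigcup_{i=1}^nC_i\Big\}\ge0.$$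 For $u<t\le s$ and $x_u\in\mathcal X_u$, $T_{t,x_u}^s$ denotes the matrix with entries $T_{t,x_u}^s(x,y)=P(X_s=y\,|\,X_t=x,X_u=x_u)$, and $\mathbb E_P[f(X_s)|X_t=x,X_u=x_u]:=\sum_yf(y)\,T_{t,x_u}^s(x,y)$. The process $P$ is well-behaved if, for all $u<t$, $x_u\in\mathcal X_u$ and $x,y\in\mathcal X$, $$\limsup_{\Delta\to0^+}\tfrac1\Delta\big|T_{t,x_u}^{t+\Delta}(x,y)-\mathbb I_x(y)\big|<+\infty\quad\text{and, if }t\ne0,\quad\limsup_{\Delta\to0^+}\tfrac1\Delta\big|T_{t-\Delta,x_u}^{t}(x,y)-\mathbb I_x(y)\big|<+\infty.$$ **Rates.** A rate matrix is a real $\mathcal X\times\mathcal X$ matrix with zero row sums and non-negative off-diagonal entries. For $u<t$ and $x_u\in\mathcal X_u$, let $\overline\partial T_{t,x_u}^t$ be the set of all rate matrices that are the limit of $\frac1{\Delta_i}(T_{t,x_u}^{t+\Delta_i}-I)$ or, if $t>0$, of $\frac1{\Delta_i}(T_{t-\Delta_i,x_u}^{t}-I)$, for some sequence of $\Delta_i>0$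 with $\Delta_i\to0$. For a set $\mathcal Q$ of rate matrices, $\mathbb P^{\mathrm W}_{\mathcal Q}$ is the set of all well-behaved processes $P$ (with arbitrary initial probability mass function $P(X_0)$) that are consistent with $\mathcal Q$, i.e. $\overline\partial T_{t,x_u}^t\subseteq\mathcal Q$ for all $t\ge0$, all $u\in\mathcal U$ with $u<t$ and all $x_u\in\mathcal X_u$. **Operators.** A lower transition rate operator is a map $\underline Q:\mathcal L(\mathcal X)\to\mathcal L(\mathcal X)$ such that $\underline Q\mu=0$ for constant $\mu$, $[\underline Q\,\mathbb I_y](x)\ge0$ for $x\ne y$, $\underline Q(f+g)\ge\underline Qf+\underline Qg$, and $\underline Q(\lambda f)=\lambda\underline Qf$ for $\lambda\ge0$. Its set of dominating rate matrices is $\mathcal Q_{\underline Q}:=\{R\text{ rate matrix}:Rf\ge\underline Qf\text{ for all }f\in\mathcal L(\mathcal X)\}$. For $0\le t\le s$, the corresponding lower transition operator is $$L_t^s:=\lim(I+\Delta_1\underline Q)\cdots(I+\Delta_n\underline Q),\qquad\Delta_i=t_i-t_{i-1},$$ where the limit, in operator norm, is over all partitions $t=t_0<\dots<t_n=s$ as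 $\max_i\Delta_i\to0$; it is required to be a lower transition operator, i.e. a superadditive and non-negatively homogeneous map with $[L_t^sf](x)\ge\min f$. **Theorem.** Let $\underline Q$ be any lower transition rate operator. Then the limits $L_t^s$ exist for all $0\le t\le s$, and the largest (with respect to inclusion) non-empty set $\mathcal P$ of stochastic processes such that $$\inf_{P\in\mathcal P}\mathbb E_P[f(X_s)\,|\,X_t=x_t,X_u=x_u]=[L_t^sf](x_t)$$ for all $0\le t\le s$, all $u\in\mathcal U$ with $u<t$, all $x_t\in\mathcal X$, $x_u\in\mathcal X_u$ and $f\in\mathcal L(\mathcal X)$ is $\mathbb P^{\mathrm W}_{\mathcal Q_{\underline Q}}$: this set has the stated property, and it contains every set that has it. -/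

import Mathlib

open Filter Topology Set
open scoped NNReal Matrix

noncomputable section

namespace ImpreciseCTMC

/-! ### Events and stochastic processes

Time is `ℝ≥0`. A path is a function `ℝ≥0 → X`, and the outcome space `Ω` is a set of paths.
A finite, ordered, non-degenerate (possibly empty) sequence of time points is a
`u : Finset ℝ≥0`, and a joint state on `u` is a function `xu : u → X`. -/

/-- The outcome space contains, for every non-empty finite sequence of time points and every
assignment of states to these time points, a path that agrees with this assignment. -/
def IsRichPathSpace {X : Type*} (Ω : Set (ℝ≥0 → X)) : Prop :=
  ∀ u : Finset ℝ≥0, u.Nonempty → ∀ xu : u → X, ∃ ω : Ω, ∀ r : u, ω.1 r = xu r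

/-- The event `(X_t = x)`. -/
def stateEvent {X : Type*} (Ω : Set (ℝ≥0 → X)) (t : ℝ≥0) (x : X) : Set Ω :=
  {ω | ω.1 t = x}

/-- The event `(X_u = x_u)`; it is the whole of `Ω` if `u` is empty. -/
def historyEvent {X : Type*} (Ω : Set (ℝ≥0 → X)) (u : Finset ℝ≥0) (xu : u → X) : Set Ω :=
  {ω | ∀ r : u, ω.1 r = xu r}

/-- `u < t`: every time point in `u` is strictly smaller than `t` (vacuous if `u` is empty). -/
def Precedes (u : Finset ℝ≥0) (t : ℝ≥0) : Prop := ∀ r ∈ u, r < t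

/-- The elementary events `(X_t = x)` with `t ∈ u` or `t > u`. -/
def elementaryEvents {X : Type*} (Ω : Set (ℝ≥0 → X)) (u : Finset ℝ≥0) : Set (Set Ω) :=
  {E | ∃ (t : ℝ≥0) (x : X), (t ∈ u ∨ Precedes u t) ∧ E = stateEvent Ω t x}

/-- The algebra of events generated by the elementary events whose time point belongs to `u` or
comes after `u`. -/
def eventAlgebra {X : Type*} (Ω : Set (ℝ≥0 → X)) (u : Finset ℝ≥0) : Set (Set Ω) :=
  MeasureTheory.generateSetAlgebra (elementaryEvents Ω u)

/-- The domain of a stochastic process: all pairs `(A, X_u = x_u)` with `A` in the algebra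
`eventAlgebra Ω u`. -/
def processDomain {X : Type*} (Ω : Set (ℝ≥0 → X)) : Set (Set Ω × Set Ω) :=
  {p | ∃ (u : Finset ℝ≥0) (xu : u → X), p.1 ∈ eventAlgebra Ω u ∧ p.2 = historyEvent Ω u xu}

/-- Coherence of a real-valued map `P` on a set `D` of pairs (event, conditioning event): for all
`n ≥ 1`, all pairs `(A i, C i) ∈ D` and all `l i ∈ ℝ`,
`max {∑ i, l i * 𝟙_{C i}(ω) * (P (A i | C i) - 𝟙_{A i}(ω)) | ω ∈ ⋃ i, C i} ≥ 0`.
The sum takes only finitely many values, so the maximum is non-negative if and only if the sum is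
non-negative for some `ω` in the union. -/
def IsCoherent {W : Type*} (D : Set (Set W × Set W)) (P : D → ℝ) : Prop :=
  ∀ (n : ℕ), 1 ≤ n → ∀ (p : Fin n → D) (l : Fin n → ℝ),
    ∃ ω ∈ ⋃ i, (p i).1.2,
      0 ≤ ∑ i, l i * (p i).1.2.indicator (1 : W → ℝ) ω *
        (P (p i) - (p i).1.1.indicator (1 : W → ℝ) ω)

/-- A stochastic process is a coherent conditional probability on `processDomain Ω`. -/
def StochasticProcess {X : Type*} (Ω : Set (ℝ≥0 → X)) : Type _ :=
  {P : processDomain Ω → ℝ // IsCoherent (processDomain Ω) P}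

open Classical in
/-- `P(A | C)`, with the default value `0` for pairs outside of the domain of `P`. -/
def StochasticProcess.prob {X : Type*} {Ω : Set (ℝ≥0 → X)} (P : StochasticProcess Ω)
    (A C : Set Ω) : ℝ :=
  if h : (A, C) ∈ processDomain Ω then P.1 ⟨(A, C), h⟩ else 0

/-- The pair `(X_s = y, (X_t = x, X_u = x_u))` is in the domain if `u < t ≤ s`, so that the default
value of `StochasticProcess.prob` plays no role for such pairs. -/
theorem mem_processDomain {X : Type*} (Ω : Set (ℝ≥0 → X)) {u : Finset ℝ≥0} {t s : ℝ≥0}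
    (hu : Precedes u t) (hts : t ≤ s) (xu : u → X) (x y : X) :
    (stateEvent Ω s y, stateEvent Ω t x ∩ historyEvent Ω u xu) ∈ processDomain Ω := by
  classical
  refine ⟨insert t u, fun r => if h : (r : ℝ≥0) ∈ u then xu ⟨r, h⟩ else x, ?_, ?_⟩
  · refine MeasureTheory.generateSetAlgebra.base _ ⟨s, y, ?_, rfl⟩
    rcases hts.eq_or_lt with h | h
    · left; simp [h]
    · right
      intro r hr
      rcases Finset.mem_insert.1 hr with h' | h'
      · exact h' ▸ h
      · exact (hu r h').trans h
  · have htu : t ∉ u := fun h => lt_irrefl _ (hu t h)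
    ext ω
    simp only [stateEvent, historyEvent, Set.mem_inter_iff, Set.mem_ofPred_eq, Subtype.forall,
      Finset.mem_insert]
    constructor
    · rintro ⟨h1, h2⟩ r hr
      by_cases h : r ∈ u
      · simpa [h] using h2 r h
      · rcases hr with hr | hr
        · subst hr; simpa [h] using h1
        · exact absurd hr h
    · intro h
      refine ⟨by simpa [htu] using h t (Or.inl rfl), fun r hr => ?_⟩
      simpa [hr] using h r (Or.inr hr)

/-- The pair `(X_0 = x, Ω)` is in the domain. -/
theorem mem_processDomain_univ {X : Type*} (Ω : Set (ℝ≥0 → X)) (s : ℝ≥0) (x : X) :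
    (stateEvent Ω s x, (Set.univ : Set Ω)) ∈ processDomain Ω := by
  refine ⟨∅, fun r => absurd r.2 (Finset.notMem_empty _), ?_, ?_⟩
  · exact MeasureTheory.generateSetAlgebra.base _
      ⟨s, x, Or.inr (fun r hr => absurd hr (Finset.notMem_empty _)), rfl⟩
  · ext ω
    simp [historyEvent]

/-! ### Well-behaved processes and their dynamics -/

/-- `P` is well-behaved: its rate of change is locally bounded, from the right at every `t > u`, and
from the left if moreover `t ≠ 0`. The limits superior are taken in `[-∞, +∞]`. -/
def IsWellBehaved {X : Type*} [DecidableEq X] {Ω : Set (ℝ≥0 → X)}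
    (P : StochasticProcess Ω) : Prop :=
  ∀ (u : Finset ℝ≥0) (xu : u → X) (x y : X) (t : ℝ≥0), Precedes u t →
    limsup (fun d : ℝ≥0 => ((1 / (d : ℝ) *
        |P.prob (stateEvent Ω (t + d) y) (stateEvent Ω t x ∩ historyEvent Ω u xu)
          - if y = x then 1 else 0| : ℝ) : EReal)) (𝓝[>] 0) < ⊤ ∧
    (t ≠ 0 →
      limsup (fun d : ℝ≥0 => ((1 / (d : ℝ) *
        |P.prob (stateEvent Ω t y) (stateEvent Ω (t - d) x ∩ historyEvent Ω u xu)
          - if y = x then 1 else 0| : ℝ) : EReal)) (𝓝[>] 0) < ⊤)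

/-- The history-dependent transition matrix from time `t` to time `s`, for the history `x_u`:
its `(x, y)` entry is `P(X_s = y | X_t = x, X_u = x_u)`. -/
def transitionMatrix {X : Type*} {Ω : Set (ℝ≥0 → X)} (P : StochasticProcess Ω)
    (u : Finset ℝ≥0) (xu : u → X) (t s : ℝ≥0) : Matrix X X ℝ :=
  Matrix.of fun x y => P.prob (stateEvent Ω s y) (stateEvent Ω t x ∩ historyEvent Ω u xu)

/-- (Transition) rate matrices. -/
structure IsRateMatrix {X : Type*} [Fintype X] (R : Matrix X X ℝ) : Prop where
  row_sum : ∀ x, ∑ y, R x y = 0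
  off_diag : ∀ x y, x ≠ y → 0 ≤ R x y

/-- The right-sided outer partial derivative at `t`, for the history `x_u`. -/
def rightOuterDerivative {X : Type*} [Fintype X] [DecidableEq X] {Ω : Set (ℝ≥0 → X)}
    (P : StochasticProcess Ω) (u : Finset ℝ≥0) (xu : u → X) (t : ℝ≥0) : Set (Matrix X X ℝ) :=
  {R | IsRateMatrix R ∧ ∃ d : ℕ → ℝ≥0, (∀ i, 0 < d i) ∧ Tendsto d atTop (𝓝 0) ∧
    Tendsto (fun i => (1 / (d i : ℝ)) • (transitionMatrix P u xu t (t + d i) - 1)) atTop (𝓝 R)}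

/-- The left-sided outer partial derivative at `t ≠ 0`, for the history `x_u`. -/
def leftOuterDerivative {X : Type*} [Fintype X] [DecidableEq X] {Ω : Set (ℝ≥0 → X)}
    (P : StochasticProcess Ω) (u : Finset ℝ≥0) (xu : u → X) (t : ℝ≥0) : Set (Matrix X X ℝ) :=
  {R | IsRateMatrix R ∧ ∃ d : ℕ → ℝ≥0, (∀ i, 0 < d i) ∧ Tendsto d atTop (𝓝 0) ∧
    Tendsto (fun i => (1 / (d i : ℝ)) • (transitionMatrix P u xu (t - d i) t - 1)) atTop (𝓝 R)}

/-- The outer partial derivative at `t`, for the history `x_u`. -/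
def outerDerivative {X : Type*} [Fintype X] [DecidableEq X] {Ω : Set (ℝ≥0 → X)}
    (P : StochasticProcess Ω) (u : Finset ℝ≥0) (xu : u → X) (t : ℝ≥0) : Set (Matrix X X ℝ) :=
  {R | R ∈ rightOuterDerivative P u xu t ∨ (0 < t ∧ R ∈ leftOuterDerivative P u xu t)}

/-- Consistency of a process with a set of rate matrices. -/
def IsConsistent {X : Type*} [Fintype X] [DecidableEq X] {Ω : Set (ℝ≥0 → X)}
    (P : StochasticProcess Ω) (𝓠 : Set (Matrix X X ℝ)) : Prop :=
  ∀ (t : ℝ≥0) (u : Finset ℝ≥0), Precedes u t → ∀ xu : u → X, outerDerivative P u xu t ⊆ 𝓠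

/-- The initial distribution `x ↦ P(X_0 = x)` of a process. -/
def initialDistribution {X : Type*} {Ω : Set (ℝ≥0 → X)} (P : StochasticProcess Ω) : X → ℝ :=
  fun x => P.prob (stateEvent Ω 0 x) Set.univ

/-- The well-behaved processes that are consistent with the set `𝓠` of rate matrices and the set `M`
of initial probability mass functions. -/
def consistentProcessesWithInitial {X : Type*} [Fintype X] [DecidableEq X] (Ω : Set (ℝ≥0 → X))
    (𝓠 : Set (Matrix X X ℝ)) (M : Set (X → ℝ)) : Set (StochasticProcess Ω) :=
  {P | IsWellBehaved P ∧ IsConsistent P 𝓠 ∧ initialDistribution P ∈ M}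

/-- The well-behaved processes that are consistent with `𝓠`, all initial probability mass functions
being allowed. -/
def consistentProcesses {X : Type*} [Fintype X] [DecidableEq X] (Ω : Set (ℝ≥0 → X))
    (𝓠 : Set (Matrix X X ℝ)) : Set (StochasticProcess Ω) :=
  consistentProcessesWithInitial Ω 𝓠 (stdSimplex ℝ X)

/-! ### Conditional (lower) expectations -/

/-- The conditional expectation `E_P[f(X_s) | X_t = x, X_u = x_u]`. -/
def condExpectation {X : Type*} [Fintype X] {Ω : Set (ℝ≥0 → X)} (P : StochasticProcess Ω)
    (u : Finset ℝ≥0) (xu : u → X) (t : ℝ≥0) (x : X) (s : ℝ≥0) (f : X → ℝ) : ℝ :=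
  ∑ y, f y * P.prob (stateEvent Ω s y) (stateEvent Ω t x ∩ historyEvent Ω u xu)

/-- The conditional lower expectation of `f(X_s)` given `X_t = x, X_u = x_u` with respect to a
non-empty set `𝓢` of processes. -/
def lowerExpectation {X : Type*} [Fintype X] {Ω : Set (ℝ≥0 → X)} (𝓢 : Set (StochasticProcess Ω))
    (u : Finset ℝ≥0) (xu : u → X) (t : ℝ≥0) (x : X) (s : ℝ≥0) (f : X → ℝ) : ℝ :=
  sInf {e | ∃ P ∈ 𝓢, e = condExpectation P u xu t x s f}

theorem StochasticProcess.prob_mem_Icc {X : Type*} {Ω : Set (ℝ≥0 → X)} (P : StochasticProcess Ω)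
    (A C : Set Ω) : P.prob A C ∈ Set.Icc (0 : ℝ) 1 := by
  classical
  unfold StochasticProcess.prob
  split_ifs with h
  · obtain ⟨ω, hω, h1⟩ := P.2 1 le_rfl (fun _ => ⟨(A, C), h⟩) (fun _ => 1)
    obtain ⟨ω', hω', h2⟩ := P.2 1 le_rfl (fun _ => ⟨(A, C), h⟩) (fun _ => -1)
    simp only [Set.mem_iUnion, exists_const] at hω hω'
    simp only [Finset.univ_unique, Finset.sum_singleton, Set.indicator_of_mem hω,
      Set.indicator_of_mem hω', Pi.one_apply] at h1 h2
    have h3 : 0 ≤ A.indicator (1 : Ω → ℝ) ω := Set.indicator_nonneg (by simp) _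
    have h4 : A.indicator (1 : Ω → ℝ) ω' ≤ 1 := by
      by_cases h : ω' ∈ A <;> simp [h]
    constructor <;> linarith
  · simp

/-- The infimum in `lowerExpectation` is a genuine one: it is over a set of reals that is non-empty
and bounded below. -/
theorem isGLB_lowerExpectation {X : Type*} [Fintype X] {Ω : Set (ℝ≥0 → X)}
    {𝓢 : Set (StochasticProcess Ω)} (hne : 𝓢.Nonempty)
    (u : Finset ℝ≥0) (xu : u → X) (t : ℝ≥0) (x : X) (s : ℝ≥0) (f : X → ℝ) :
    IsGLB {e | ∃ P ∈ 𝓢, e = condExpectation P u xu t x s f}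
      (lowerExpectation 𝓢 u xu t x s f) := by
  obtain ⟨P, hP⟩ := hne
  refine isGLB_csInf ⟨_, P, hP, rfl⟩ ⟨-∑ y, |f y|, ?_⟩
  rintro _ ⟨P', -, rfl⟩
  rw [condExpectation, ← Finset.sum_neg_distrib]
  refine Finset.sum_le_sum fun y _ => ?_
  have h := P'.prob_mem_Icc (stateEvent Ω s y) (stateEvent Ω t x ∩ historyEvent Ω u xu)
  have h1 := neg_abs_le (f y)
  nlinarith [h.1, h.2, abs_nonneg (f y),
    mul_le_mul_of_nonneg_right h1 h.1, mul_le_mul_of_nonneg_left h.2 (abs_nonneg (f y))]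

/-! ### Lower transition (rate) operators -/

/-- Lower transition operators. -/
structure IsLowerTransitionOperator {X : Type*} (T : (X → ℝ) → (X → ℝ)) : Prop where
  min_le : ∀ (f : X → ℝ) (x : X), ⨅ y, f y ≤ T f x
  superadditive : ∀ (f g : X → ℝ) (x : X), T f x + T g x ≤ T (f + g) x
  homogeneous : ∀ (c : ℝ) (f : X → ℝ) (x : X), 0 ≤ c → T (c • f) x = c * T f x

/-- Lower transition rate operators. -/
structure IsLowerTransitionRateOperator {X : Type*} [DecidableEq X]
    (Q : (X → ℝ) → (X → ℝ)) : Prop where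
  const_zero : ∀ (c : ℝ) (x : X), Q (fun _ => c) x = 0
  off_diag : ∀ x y : X, x ≠ y → 0 ≤ Q (Pi.single y 1) x
  superadditive : ∀ (f g : X → ℝ) (x : X), Q f x + Q g x ≤ Q (f + g) x
  homogeneous : ∀ (c : ℝ) (f : X → ℝ) (x : X), 0 ≤ c → Q (c • f) x = c * Q f x

/-- The set of rate matrices that dominate `Q`. -/
def dominatingRateMatrices {X : Type*} [Fintype X] (Q : (X → ℝ) → (X → ℝ)) :
    Set (Matrix X X ℝ) :=
  {R | IsRateMatrix R ∧ ∀ (f : X → ℝ) (x : X), Q f x ≤ (R *ᵥ f) x}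

/-- `τ 0 < τ 1 < ⋯ < τ n` is a partition of `[t, s]`; the values of `τ` after `n` are irrelevant. -/
def IsPartition (t s : ℝ≥0) (n : ℕ) (τ : ℕ → ℝ≥0) : Prop :=
  τ 0 = t ∧ τ n = s ∧ ∀ i < n, τ i < τ (i + 1)

/-- The composition `(I + Δ₁ Q) ∘ ⋯ ∘ (I + Δₙ Q)` with `Δᵢ = τ i - τ (i - 1)`. -/
def partitionOperator {X : Type*} (Q : (X → ℝ) → (X → ℝ)) (τ : ℕ → ℝ≥0) :
    ℕ → (X → ℝ) → (X → ℝ)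
  | 0 => id
  | n + 1 => partitionOperator Q τ n ∘ fun f => f + ((τ (n + 1) : ℝ) - τ n) • Q f

/-- `T` is the lower transition operator that is the limit, in the operator norm that is induced by
the supremum norm, of the operators `partitionOperator Q τ n`, as the mesh of the partition
`τ 0 < ⋯ < τ n` of `[t, s]` goes to zero. -/
def IsCorrespondingLowerTransitionOperator {X : Type*} [Fintype X] (Q : (X → ℝ) → (X → ℝ))
    (t s : ℝ≥0) (T : (X → ℝ) → (X → ℝ)) : Prop :=
  IsLowerTransitionOperator T ∧
  ∀ ε : ℝ, 0 < ε → ∃ δ : ℝ, 0 < δ ∧ ∀ (n : ℕ) (τ : ℕ → ℝ≥0), IsPartition t s n τ →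
    (∀ i < n, (τ (i + 1) : ℝ) - τ i ≤ δ) →
      ∀ f : X → ℝ, ‖f‖ = 1 → ‖T f - partitionOperator Q τ n f‖ ≤ ε

/-- The lower transition operator `L_t^s` corresponding to `Q`, for `t ≤ s`. -/
def lowerTransitionOperator {X : Type*} [Fintype X] (Q : (X → ℝ) → (X → ℝ)) (t s : ℝ≥0) :
    (X → ℝ) → (X → ℝ) :=
  Classical.epsilon (IsCorrespondingLowerTransitionOperator Q t s)

end ImpreciseCTMC

end

open ImpreciseCTMC

set_option linter.unusedSectionVars false

namespace ImpreciseCTMC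

/-! ### Lower transition operators -/

section LowerTransitionOperators

variable {X : Type*} [Fintype X]

/-! Everything reduces to a one-parameter semigroup `S` of lower transition operators with `S d = I
+ d Q + O(d²)`, so that `L_t^s = S (s - t)`. For small steps `I + h Q` is a lower transition
operator, hence nonexpansive, and ultralimits of its iterates provide `S`. Nonexpansiveness then
sums the local errors along any partition, so the partition products converge to `S (s - t)`; this
gives existence and uniqueness of the limits.

The central fact is that a process `P` lies in the consistent set if and only if it dominates the
semigroup: `S (s - t) f x ≤ E_P[f(X_s) | X_t = x, X_u = x_u]` always.

If `P` dominates `S`, applying this to `f` and `-f` bounds the difference quotients, and their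
limits dominate `Q` because the error is of order `d²` (`mem_consistentProcesses`). Every member of
a set whose lower expectations are `L_t^s` dominates `S`, which is the maximality.

Conversely, for a consistent `P` the function `r ↦ E_P[(S (s - r) f)(X_r) | X_t = x, X_u = x_u]`
rises from `S (s - t) f x` to the conditional expectation of `f(X_s)`. It is nondecreasing because
consistency, made uniform in `f` by compactness, bounds its one-sided increments below by `-ε d`; a
supremum argument globalises this (`le_condExpectation`).

It remains to attain the lower bound, for given `s` and `f`, by one dominating process
(`exists_process`). On a finite time grid, such a process is approximated by sampling each new state
from a probability mass function that dominates `S` and attains it at the current value function;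
Hahn–Banach supplies this function. A little uniform noise gives every history positive probability.
An ultralimit over all finite grids removes the noise, and coherence survives because a finite
combination of bets sees only finitely many outcome patterns. -/

theorem iInf_le_apply (f : X → ℝ) (x : X) : ⨅ y, f y ≤ f x :=
  ciInf_le (finite_range f).bddBelow x

theorem neg_norm_le_apply (f : X → ℝ) (x : X) : -‖f‖ ≤ f x :=
  neg_le_of_abs_le (norm_le_pi_norm f x)

theorem IsLowerTransitionOperator.id : IsLowerTransitionOperator (id : (X → ℝ) → X → ℝ) where
  min_le := iInf_le_apply
  superadditive _ _ _ := le_rfl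
  homogeneous _ _ _ _ := rfl

variable [Nonempty X] {T U : (X → ℝ) → X → ℝ}

theorem IsLowerTransitionOperator.le_of_forall_le (hT : IsLowerTransitionOperator T)
    {f : X → ℝ} {c : ℝ} (h : ∀ y, c ≤ f y) (x : X) : c ≤ T f x :=
  (le_ciInf h).trans (hT.min_le f x)

theorem IsLowerTransitionOperator.sub_le (hT : IsLowerTransitionOperator T) (f g : X → ℝ)
    (x : X) : T (f - g) x ≤ T f x - T g x := by
  have h := hT.superadditive (f - g) g x
  rw [sub_add_cancel] at h
  linarith

theorem IsLowerTransitionOperator.monotone (hT : IsLowerTransitionOperator T) {f g : X → ℝ}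
    (h : ∀ y, f y ≤ g y) (x : X) : T f x ≤ T g x := by
  have h1 := hT.sub_le g f x
  have h2 := hT.le_of_forall_le (f := g - f) (c := 0) (fun y => sub_nonneg.2 (h y)) x
  linarith

theorem IsLowerTransitionOperator.map_zero (hT : IsLowerTransitionOperator T) (x : X) :
    T 0 x = 0 := by
  simpa using hT.homogeneous 0 0 x le_rfl

/-- Superadditivity gives `T f - T g ≥ T (f - g) ≥ -‖f - g‖`, and symmetrically. This
nonexpansiveness is what lets local errors be added along a partition. -/
theorem IsLowerTransitionOperator.norm_sub_le (hT : IsLowerTransitionOperator T)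
    (f g : X → ℝ) : ‖T f - T g‖ ≤ ‖f - g‖ := by
  refine (pi_norm_le_iff_of_nonneg (norm_nonneg _)).2 fun x => ?_
  have h1 := hT.sub_le f g x
  have h2 := hT.sub_le g f x
  have h3 := hT.le_of_forall_le (neg_norm_le_apply (f - g)) x
  have h4 := hT.le_of_forall_le (neg_norm_le_apply (g - f)) x
  rw [norm_sub_rev g f] at h4
  rw [Real.norm_eq_abs, abs_le, Pi.sub_apply]
  constructor <;> linarith

theorem IsLowerTransitionOperator.norm_le (hT : IsLowerTransitionOperator T) (f : X → ℝ) :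
    ‖T f‖ ≤ ‖f‖ := by
  have h : T 0 = 0 := funext hT.map_zero
  simpa [h] using hT.norm_sub_le f 0

theorem IsLowerTransitionOperator.comp (hT : IsLowerTransitionOperator T)
    (hU : IsLowerTransitionOperator U) : IsLowerTransitionOperator (T ∘ U) where
  min_le f := hT.le_of_forall_le (hU.min_le f)
  superadditive f g x := (hT.superadditive _ _ x).trans (hT.monotone (hU.superadditive f g) x)
  homogeneous c f x hc := by
    have h : U (c • f) = c • U f := funext fun y => hU.homogeneous c f y hc
    simp only [Function.comp, h, hT.homogeneous c _ x hc]

theorem IsLowerTransitionOperator.iterate (hT : IsLowerTransitionOperator T) (n : ℕ) :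
    IsLowerTransitionOperator T^[n] := by
  induction n with
  | zero => exact .id
  | succ n ih => exact ih.comp hT

theorem IsLowerTransitionOperator.norm_iterate_sub_le (hT : IsLowerTransitionOperator T)
    (f : X → ℝ) (n : ℕ) : ‖T^[n] f - f‖ ≤ n * ‖T f - f‖ := by
  induction n with
  | zero => simp
  | succ n ih =>
    have h := (hT.iterate n).norm_sub_le (T f) f
    rw [Function.iterate_succ_apply]
    push_cast
    linarith [norm_sub_le_norm_sub_add_norm_sub (T^[n] (T f)) (T^[n] f) f]

/-- A pointwise limit of lower transition operators is a lower transition operator. -/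
theorem IsLowerTransitionOperator.of_tendsto {ι : Type*} {l : Filter ι} [l.NeBot]
    {T : ι → (X → ℝ) → X → ℝ} {U : (X → ℝ) → X → ℝ}
    (hT : ∀ᶠ i in l, IsLowerTransitionOperator (T i))
    (h : ∀ f, Tendsto (fun i => T i f) l (𝓝 (U f))) : IsLowerTransitionOperator U := by
  have h' : ∀ f x, Tendsto (fun i => T i f x) l (𝓝 (U f x)) := fun f x =>
    (continuous_apply x).continuousAt.tendsto.comp (h f)
  refine ⟨fun f x => ?_, fun f g x => ?_, fun c f x hc => ?_⟩
  · exact ge_of_tendsto (h' f x) (hT.mono fun i hi => hi.min_le f x)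
  · exact le_of_tendsto_of_tendsto ((h' f x).add (h' g x)) (h' _ x)
      (hT.mono fun i hi => hi.superadditive f g x)
  · exact tendsto_nhds_unique_of_eventuallyEq (h' _ x) ((h' f x).const_mul c)
      (hT.mono fun i hi => hi.homogeneous c f x hc)

end LowerTransitionOperators

/-! ### Lower transition rate operators -/

section RateOperators

variable {X : Type*} [Fintype X] [DecidableEq X] {Q : (X → ℝ) → X → ℝ}

/-- A bound on the norm of a lower transition rate operator. -/
def rateBound (Q : (X → ℝ) → X → ℝ) : ℝ :=
  ∑ x, ∑ y, (|Q (Pi.single y 1) x| + |Q (-Pi.single y 1) x|)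

theorem IsLowerTransitionRateOperator.map_zero (hQ : IsLowerTransitionRateOperator Q) (x : X) :
    Q 0 x = 0 := by
  simpa using hQ.homogeneous 0 0 x le_rfl

theorem rateBound_nonneg : 0 ≤ rateBound Q := by
  unfold rateBound; positivity

theorem IsLowerTransitionRateOperator.sum_le (hQ : IsLowerTransitionRateOperator Q) (x : X)
    {ι : Type*} (s : Finset ι) (f : ι → X → ℝ) :
    ∑ i ∈ s, Q (f i) x ≤ Q (∑ i ∈ s, f i) x := by
  classical
  induction s using Finset.induction_on with
  | empty => simp [hQ.map_zero]
  | insert i s hi ih =>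
    rw [Finset.sum_insert hi, Finset.sum_insert hi]
    linarith [hQ.superadditive (f i) (∑ j ∈ s, f j) x]

theorem sum_abs_le_rateBound (x : X) :
    ∑ y, (|Q (Pi.single y 1) x| + |Q (-Pi.single y 1) x|) ≤ rateBound Q :=
  Finset.single_le_sum (f := fun x => ∑ y, (|Q (Pi.single y 1) x| + |Q (-Pi.single y 1) x|))
    (fun _ _ => by positivity) (Finset.mem_univ x)

/-- Superadditivity splits `f` into its coordinates. Homogeneity holds for non-negative scalars
only, so a negative coordinate is a multiple of `-Pi.single y 1`; hence both signs occur in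
`rateBound`. -/
theorem IsLowerTransitionRateOperator.neg_le_apply (hQ : IsLowerTransitionRateOperator Q)
    (f : X → ℝ) (x : X) : -(rateBound Q * ‖f‖) ≤ Q f x := by
  have key : ∀ y, -((|Q (Pi.single y 1) x| + |Q (-Pi.single y 1) x|) * ‖f‖)
      ≤ Q (Pi.single y (f y)) x := by
    intro y
    have h1 : |f y| ≤ ‖f‖ := norm_le_pi_norm f y
    have h2 := abs_nonneg (Q (Pi.single y 1) x)
    have h3 := abs_nonneg (Q (-Pi.single y 1) x)
    rcases le_total 0 (f y) with h | h
    · have e : (Pi.single y (f y) : X → ℝ) = f y • Pi.single y 1 := by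
        rw [← Pi.single_smul]; simp
      rw [e, hQ.homogeneous _ _ _ h]
      rw [abs_of_nonneg h] at h1
      have := neg_abs_le (Q (Pi.single y 1) x)
      nlinarith [mul_le_mul_of_nonneg_left this h, mul_le_mul_of_nonneg_right h1 h2,
        mul_nonneg h3 (norm_nonneg f)]
    · have e : (Pi.single y (f y) : X → ℝ) = (-f y) • -Pi.single y 1 := by
        rw [smul_neg, neg_smul, neg_neg, ← Pi.single_smul]; simp
      rw [e, hQ.homogeneous _ _ _ (neg_nonneg.2 h)]
      rw [abs_of_nonpos h] at h1
      have := neg_abs_le (Q (-Pi.single y 1) x)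
      nlinarith [mul_le_mul_of_nonneg_left this (neg_nonneg.2 h),
        mul_le_mul_of_nonneg_right h1 h3, mul_nonneg h2 (norm_nonneg f)]
  calc -(rateBound Q * ‖f‖)
      ≤ -((∑ y, (|Q (Pi.single y 1) x| + |Q (-Pi.single y 1) x|)) * ‖f‖) :=
        neg_le_neg (mul_le_mul_of_nonneg_right (sum_abs_le_rateBound x) (norm_nonneg f))
    _ = ∑ y, -((|Q (Pi.single y 1) x| + |Q (-Pi.single y 1) x|) * ‖f‖) := by
        rw [Finset.sum_mul, Finset.sum_neg_distrib]
    _ ≤ ∑ y, Q (Pi.single y (f y)) x := Finset.sum_le_sum fun y _ => key y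
    _ ≤ Q (∑ y, Pi.single y (f y)) x := hQ.sum_le x _ _
    _ = Q f x := by rw [Finset.univ_sum_single]

theorem IsLowerTransitionRateOperator.norm_sub_le (hQ : IsLowerTransitionRateOperator Q)
    (f g : X → ℝ) : ‖Q f - Q g‖ ≤ rateBound Q * ‖f - g‖ := by
  refine (pi_norm_le_iff_of_nonneg (mul_nonneg rateBound_nonneg (norm_nonneg _))).2 fun x => ?_
  have h1 := hQ.superadditive (f - g) g x
  have h2 := hQ.superadditive (g - f) f x
  have h3 := hQ.neg_le_apply (f - g) x
  have h4 := hQ.neg_le_apply (g - f) x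
  rw [norm_sub_rev g f] at h4
  rw [sub_add_cancel] at h1 h2
  rw [Real.norm_eq_abs, abs_le, Pi.sub_apply]
  constructor <;> linarith

theorem IsLowerTransitionRateOperator.norm_le (hQ : IsLowerTransitionRateOperator Q)
    (f : X → ℝ) : ‖Q f‖ ≤ rateBound Q * ‖f‖ := by
  have h : Q 0 = 0 := funext hQ.map_zero
  simpa [h] using hQ.norm_sub_le f 0

theorem IsLowerTransitionRateOperator.continuous (hQ : IsLowerTransitionRateOperator Q) :
    Continuous Q := by
  refine (LipschitzWith.of_dist_le_mul (K := ⟨rateBound Q, rateBound_nonneg⟩)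
    fun f g => ?_).continuous
  rw [dist_eq_norm, dist_eq_norm]
  exact hQ.norm_sub_le f g

/-- One step `I + h Q` of the Euler scheme. -/
def eulerStep (Q : (X → ℝ) → X → ℝ) (h : ℝ) : (X → ℝ) → X → ℝ := fun f => f + h • Q f

/-- With `m = min f`, write `f` as `m` plus a non-negative combination of indicators. Off-diagonal
terms only help, and the diagonal one costs at most `h * rateBound Q * (f x - m)`, which is at most
`f x - m` for small `h`. -/
theorem IsLowerTransitionRateOperator.eulerStep [Nonempty X]
    (hQ : IsLowerTransitionRateOperator Q) {h : ℝ} (h0 : 0 ≤ h) (h1 : h * rateBound Q ≤ 1) :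
    IsLowerTransitionOperator (eulerStep Q h) where
  superadditive f g x := by
    have := mul_le_mul_of_nonneg_left (hQ.superadditive f g x) h0
    simp only [ImpreciseCTMC.eulerStep, Pi.add_apply, Pi.smul_apply, smul_eq_mul]
    linarith
  homogeneous c f x hc := by
    simp only [ImpreciseCTMC.eulerStep, Pi.add_apply, Pi.smul_apply, smul_eq_mul,
      hQ.homogeneous c f x hc]
    ring
  min_le f x := by
    set m := ⨅ y, f y
    have hf : ∀ y, 0 ≤ f y - m := fun y => sub_nonneg.2 (iInf_le_apply f y)
    have e : f = (fun _ => m) + ∑ y, Pi.single y (f y - m) := by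
      rw [Finset.univ_sum_single]; ext y; simp
    have h2 := hQ.superadditive (fun _ => m) (∑ y, Pi.single y (f y - m)) x
    rw [← e, hQ.const_zero, zero_add] at h2
    have h3 := hQ.sum_le x Finset.univ fun y => Pi.single y (f y - m)
    have h4 : ∀ y, (Pi.single y (f y - m) : X → ℝ) = (f y - m) • Pi.single y 1 := fun y => by
      rw [← Pi.single_smul]; simp
    have h5 : (f x - m) * Q (Pi.single x 1) x ≤ ∑ y, Q (Pi.single y (f y - m)) x := by
      rw [← Finset.add_sum_erase _ _ (Finset.mem_univ x), h4 x, hQ.homogeneous _ _ _ (hf x)]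
      refine le_add_of_nonneg_right (Finset.sum_nonneg fun y hy => ?_)
      rw [h4, hQ.homogeneous _ _ _ (hf y)]
      exact mul_nonneg (hf y) (hQ.off_diag x y (Finset.ne_of_mem_erase hy).symm)
    have h6 : -rateBound Q ≤ Q (Pi.single x 1) x := by
      have h7 := sum_abs_le_rateBound (Q := Q) x
      have h8 := Finset.single_le_sum
        (f := fun y => |Q (Pi.single y 1) x| + |Q (-Pi.single y 1) x|)
        (fun _ _ => by positivity) (Finset.mem_univ x)
      have h9 := neg_abs_le (Q (Pi.single x 1) x)
      have := abs_nonneg (Q (-Pi.single x 1) x)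
      simp only at h8
      linarith
    have h10 : (f x - m) * -rateBound Q ≤ Q f x :=
      (mul_le_mul_of_nonneg_left h6 (hf x)).trans (h5.trans (h3.trans h2))
    have h11 := mul_le_mul_of_nonneg_left h10 h0
    simp only [ImpreciseCTMC.eulerStep, Pi.add_apply, Pi.smul_apply, smul_eq_mul]
    nlinarith [mul_le_mul_of_nonneg_left h1 (hf x)]

/-- The `j`-th step adds `h • (Q g - Q f)`, where the iterate `g` is within `j h ‖Q f‖` of `f`;
Lipschitz continuity of `Q` makes the sum quadratic in `n h`, independently of how fine the steps
are. -/
theorem IsLowerTransitionRateOperator.norm_iterate_eulerStep_sub_le [Nonempty X]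
    (hQ : IsLowerTransitionRateOperator Q) {h : ℝ} (h0 : 0 ≤ h) (h1 : h * rateBound Q ≤ 1)
    (f : X → ℝ) (n : ℕ) :
    ‖(ImpreciseCTMC.eulerStep Q h)^[n] f - ImpreciseCTMC.eulerStep Q (n * h) f‖
      ≤ rateBound Q ^ 2 * (n * h) ^ 2 * ‖f‖ := by
  have hK := rateBound_nonneg (Q := Q)
  have hB := hQ.eulerStep h0 h1
  have hi : ∀ n : ℕ, ‖(ImpreciseCTMC.eulerStep Q h)^[n] f - f‖ ≤ n * (h * (rateBound Q * ‖f‖)) := by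
    intro n
    refine (hB.norm_iterate_sub_le f n).trans (mul_le_mul_of_nonneg_left ?_ n.cast_nonneg)
    rw [ImpreciseCTMC.eulerStep, add_sub_cancel_left, norm_smul, Real.norm_of_nonneg h0]
    exact mul_le_mul_of_nonneg_left (hQ.norm_le f) h0
  induction n with
  | zero => simp [ImpreciseCTMC.eulerStep]
  | succ n ih =>
    rw [Function.iterate_succ_apply']
    set g := (ImpreciseCTMC.eulerStep Q h)^[n] f
    have e : ImpreciseCTMC.eulerStep Q h g - ImpreciseCTMC.eulerStep Q ((n + 1 : ℕ) * h) f
        = (g - ImpreciseCTMC.eulerStep Q (n * h) f) + h • (Q g - Q f) := by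
      simp only [ImpreciseCTMC.eulerStep, smul_sub]
      push_cast
      rw [add_mul, one_mul, add_smul]
      abel
    have h2 : ‖h • (Q g - Q f)‖ ≤ h * (rateBound Q * (n * (h * (rateBound Q * ‖f‖)))) := by
      rw [norm_smul, Real.norm_of_nonneg h0]
      exact mul_le_mul_of_nonneg_left
        ((hQ.norm_sub_le g f).trans (mul_le_mul_of_nonneg_left (hi n) hK)) h0
    rw [e]
    refine (norm_add_le _ _).trans ((add_le_add ih h2).trans ?_)
    push_cast
    have h3 : 0 ≤ rateBound Q ^ 2 * h ^ 2 * ‖f‖ := by positivity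
    nlinarith [mul_nonneg h3 (n.cast_nonneg : (0 : ℝ) ≤ n)]

end RateOperators

/-! ### The semigroup that is generated by a lower transition rate operator -/

section Semigroup

variable {X : Type*} [Fintype X]

/-- `S` is a semigroup of lower transition operators with generator `Q`, in the quantitative sense
that `S d` is `I + d Q` up to an error of order `d ^ 2`. -/
structure IsTransitionSemigroup (Q : (X → ℝ) → X → ℝ) (C : ℝ) (S : ℝ≥0 → (X → ℝ) → X → ℝ) :
    Prop where
  nonneg : 0 ≤ C
  lower : ∀ d, IsLowerTransitionOperator (S d)
  zero : ∀ f, S 0 f = f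
  add : ∀ d e f, S (d + e) f = S d (S e f)
  approx : ∀ (d : ℝ≥0) f, ‖S d f - (f + (d : ℝ) • Q f)‖ ≤ C * d ^ 2 * ‖f‖

/-- Iterates of `I + h Q` with `h = 1 / (n + 1)` stay in a compact ball, so a limit along an
ultrafilter exists without a Cauchy estimate. -/
theorem IsLowerTransitionRateOperator.exists_semigroup [DecidableEq X] [Nonempty X]
    {Q : (X → ℝ) → X → ℝ} (hQ : IsLowerTransitionRateOperator Q) :
    ∃ S, IsTransitionSemigroup Q (rateBound Q ^ 2) S := by
  have hK := rateBound_nonneg (Q := Q)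
  set U := hyperfilter ℕ
  have hU : (U : Filter ℕ) ≤ atTop := Nat.hyperfilter_le_atTop
  let h : ℕ → ℝ := fun n => 1 / ((n : ℝ) + 1)
  let N : ℝ≥0 → ℕ → ℕ := fun d n => ⌊(d : ℝ) * (n + 1)⌋₊
  let B : ℕ → (X → ℝ) → X → ℝ := fun n => ImpreciseCTMC.eulerStep Q (h n)
  have h0 : ∀ n, 0 ≤ h n := fun n => by positivity
  have hlim : Tendsto h U (𝓝 0) := tendsto_one_div_add_atTop_nhds_zero_nat.mono_left hU
  have h1 : ∀ᶠ n in (U : Filter ℕ), h n * rateBound Q ≤ 1 := by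
    have : Tendsto (fun n => h n * rateBound Q) U (𝓝 (0 * rateBound Q)) := hlim.mul_const _
    rw [zero_mul] at this
    exact (this.eventually_lt_const one_pos).mono fun _ => le_of_lt
  have hB : ∀ᶠ n in (U : Filter ℕ), IsLowerTransitionOperator (B n) :=
    h1.mono fun n hn => hQ.eulerStep (h0 n) hn
  have hex : ∀ (d : ℝ≥0) (f : X → ℝ), ∃ g, Tendsto (fun n => (B n)^[N d n] f) U (𝓝 g) := by
    intro d f
    have : Metric.closedBall (0 : X → ℝ) ‖f‖ ∈ U.map fun n => (B n)^[N d n] f := by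
      refine Ultrafilter.mem_map.2 (hB.mono fun n hn => ?_)
      simpa using (hn.iterate (N d n)).norm_le f
    obtain ⟨g, -, hg⟩ := (isCompact_closedBall (0 : X → ℝ) ‖f‖).ultrafilter_le_nhds' _ this
    exact ⟨g, hg⟩
  choose S hS using hex
  have hlow : ∀ d, IsLowerTransitionOperator (S d) := fun d =>
    .of_tendsto (hB.mono fun n hn => hn.iterate (N d n)) (hS d)
  have hN : ∀ d : ℝ≥0, Tendsto (fun n => (N d n : ℝ) * h n) U (𝓝 d) := by
    intro d
    have h2 : ∀ n, |(N d n : ℝ) * h n - d| ≤ h n := by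
      intro n
      have hp : (0 : ℝ) < n + 1 := by positivity
      have a1 := Nat.floor_le (a := (d : ℝ) * (n + 1)) (by positivity)
      have a2 := Nat.lt_floor_add_one ((d : ℝ) * (n + 1))
      have e : (N d n : ℝ) * h n - d = ((N d n : ℝ) - d * (n + 1)) / (n + 1) := by
        simp only [h]; field_simp
      rw [e, abs_div, abs_of_pos hp]
      refine div_le_div_of_nonneg_right ?_ hp.le
      rw [abs_le]; constructor <;> linarith
    have h3 : Tendsto (fun n => (N d n : ℝ) * h n - d) U (𝓝 0) :=
      squeeze_zero_norm h2 hlim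
    simpa using h3.add_const (d : ℝ)
  refine ⟨S, by positivity, hlow, fun f => ?_, fun d e f => ?_, fun d f => ?_⟩
  · refine tendsto_nhds_unique (hS 0 f) ?_
    simp [N]
  · refine tendsto_nhds_unique (hS (d + e) f) ?_
    rw [tendsto_iff_norm_sub_tendsto_zero]
    -- Rounding costs at most one extra step of size `h n`, which disappears in the limit.
    have hsum : ∀ n, N (d + e) n = N d n + N e n ∨ N (d + e) n = N d n + N e n + 1 := by
      intro n
      have a1 := Nat.floor_le (a := (d : ℝ) * (n + 1)) (by positivity)
      have a2 := Nat.lt_floor_add_one ((d : ℝ) * (n + 1))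
      have b1 := Nat.floor_le (a := (e : ℝ) * (n + 1)) (by positivity)
      have b2 := Nat.lt_floor_add_one ((e : ℝ) * (n + 1))
      have c1 := Nat.floor_le (a := ((d + e : ℝ≥0) : ℝ) * (n + 1)) (by positivity)
      have c2 := Nat.lt_floor_add_one (((d + e : ℝ≥0) : ℝ) * (n + 1))
      push_cast at c1 c2
      have k1 : N d n + N e n < N (d + e) n + 1 := by
        have : ((N d n + N e n : ℕ) : ℝ) < ((N (d + e) n + 1 : ℕ) : ℝ) := by
          simp only [N]; push_cast; linarith
        exact_mod_cast this
      have k2 : N (d + e) n < N d n + N e n + 2 := by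
        have : ((N (d + e) n : ℕ) : ℝ) < ((N d n + N e n + 2 : ℕ) : ℝ) := by
          simp only [N]; push_cast; linarith
        exact_mod_cast this
      omega
    have hle : ∀ᶠ n in (U : Filter ℕ), ‖(B n)^[N (d + e) n] f - S d (S e f)‖ ≤
        h n * (rateBound Q * ‖f‖) + ‖(B n)^[N e n] f - S e f‖
          + ‖(B n)^[N d n] (S e f) - S d (S e f)‖ := by
      filter_upwards [hB] with n hn
      have hd := (hn.iterate (N d n)).norm_sub_le ((B n)^[N e n] f) (S e f)
      have hone : ‖(B n)^[N (d + e) n] f - (B n)^[N d n + N e n] f‖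
          ≤ h n * (rateBound Q * ‖f‖) := by
        rcases hsum n with hh | hh
        · rw [hh, sub_self, norm_zero]; have := h0 n; positivity
        · rw [hh, Function.iterate_succ_apply]
          refine ((hn.iterate _).norm_sub_le _ _).trans ?_
          simp only [B, ImpreciseCTMC.eulerStep, add_sub_cancel_left, norm_smul,
            Real.norm_of_nonneg (h0 n)]
          exact mul_le_mul_of_nonneg_left (hQ.norm_le f) (h0 n)
      rw [Function.iterate_add_apply] at hone
      linarith [norm_sub_le_norm_sub_add_norm_sub ((B n)^[N (d + e) n] f)
          ((B n)^[N d n] ((B n)^[N e n] f)) (S d (S e f)),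
        norm_sub_le_norm_sub_add_norm_sub ((B n)^[N d n] ((B n)^[N e n] f))
          ((B n)^[N d n] (S e f)) (S d (S e f))]
    refine squeeze_zero' (.of_forall fun _ => norm_nonneg _) hle ?_
    have t1 := hlim.mul_const (rateBound Q * ‖f‖)
    have t2 := tendsto_iff_norm_sub_tendsto_zero.1 (hS e f)
    have t3 := tendsto_iff_norm_sub_tendsto_zero.1 (hS d (S e f))
    simpa using (t1.add t2).add t3
  · have t1 : Tendsto (fun n => ‖(B n)^[N d n] f - ImpreciseCTMC.eulerStep Q (N d n * h n) f‖) U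
        (𝓝 ‖S d f - (f + (d : ℝ) • Q f)‖) :=
      ((hS d f).sub (tendsto_const_nhds.add ((hN d).smul_const (Q f)))).norm
    have t2 := (((hN d).pow 2).const_mul (rateBound Q ^ 2)).mul_const ‖f‖
    exact le_of_tendsto_of_tendsto t1 t2
      (h1.mono fun n hn => hQ.norm_iterate_eulerStep_sub_le (h0 n) hn f _)

variable [Nonempty X] {Q : (X → ℝ) → X → ℝ} {C : ℝ} {S : ℝ≥0 → (X → ℝ) → X → ℝ}

/-- The Euler scheme along a partition differs from the semigroup by the sum of the local errors. -/
theorem IsTransitionSemigroup.norm_sub_partitionOperator_le (hS : IsTransitionSemigroup Q C S)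
    {τ : ℕ → ℝ≥0} (n : ℕ) (hτ : ∀ i < n, τ i < τ (i + 1)) {δ : ℝ}
    (hδ : ∀ i < n, (τ (i + 1) : ℝ) - τ i ≤ δ)
    (hP : ∀ i ≤ n, IsLowerTransitionOperator (partitionOperator Q τ i)) (f : X → ℝ) :
    ‖S (τ n - τ 0) f - partitionOperator Q τ n f‖ ≤ C * δ * ((τ n : ℝ) - τ 0) * ‖f‖ := by
  have hC := hS.nonneg
  induction n generalizing f with
  | zero => simp [hS.zero, partitionOperator]
  | succ n ih =>
    have hmono : ∀ m ≤ n, τ 0 ≤ τ m := by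
      intro m hm
      induction m with
      | zero => exact le_rfl
      | succ m ihm => exact (ihm (by omega)).trans (hτ m (by omega)).le
    have h0n := hmono n le_rfl
    have hn := (hτ n (by omega)).le
    have e : τ (n + 1) - τ 0 = (τ n - τ 0) + (τ (n + 1) - τ n) := by
      rw [add_comm (τ n - τ 0), tsub_add_tsub_cancel hn h0n]
    have hd : ((τ (n + 1) - τ n : ℝ≥0) : ℝ) = (τ (n + 1) : ℝ) - τ n := NNReal.coe_sub hn
    have hn' : (0 : ℝ) ≤ (τ (n + 1) : ℝ) - τ n := sub_nonneg.2 (by exact_mod_cast hn)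
    have a := hS.approx (τ (n + 1) - τ n) f
    rw [hd] at a
    rw [e, hS.add]
    set g := S (τ (n + 1) - τ n) f
    have b := ih (fun i hi => hτ i (by omega)) (fun i hi => hδ i (by omega))
      (fun i hi => hP i (by omega)) g
    have c := (hP n (by omega)).norm_sub_le g (f + ((τ (n + 1) : ℝ) - τ n) • Q f)
    have hg : ‖g‖ ≤ ‖f‖ := (hS.lower _).norm_le f
    have h0n' : (0 : ℝ) ≤ (τ n : ℝ) - τ 0 := sub_nonneg.2 (by exact_mod_cast h0n)
    have hδn := hδ n (by omega)
    have b' : C * δ * ((τ n : ℝ) - τ 0) * ‖g‖ ≤ C * δ * ((τ n : ℝ) - τ 0) * ‖f‖ :=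
      mul_le_mul_of_nonneg_left hg
        (mul_nonneg (mul_nonneg hC (hn'.trans hδn)) h0n')
    have a' : C * ((τ (n + 1) : ℝ) - τ n) ^ 2 * ‖f‖ ≤ C * δ * ((τ (n + 1) : ℝ) - τ n) * ‖f‖ := by
      refine mul_le_mul_of_nonneg_right ?_ (norm_nonneg f)
      rw [sq, mul_assoc]
      exact mul_le_mul_of_nonneg_left (mul_le_mul_of_nonneg_right hδn hn') hC
    change ‖S (τ n - τ 0) g - partitionOperator Q τ n (f + ((τ (n + 1) : ℝ) - τ n) • Q f)‖ ≤ _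
    have := norm_sub_le_norm_sub_add_norm_sub (S (τ n - τ 0) g) (partitionOperator Q τ n g)
      (partitionOperator Q τ n (f + ((τ (n + 1) : ℝ) - τ n) • Q f))
    linarith

theorem IsLowerTransitionRateOperator.partitionOperator [DecidableEq X]
    (hQ : IsLowerTransitionRateOperator Q) {τ : ℕ → ℝ≥0} (n : ℕ)
    (hτ : ∀ i < n, τ i < τ (i + 1))
    (hδ : ∀ i < n, ((τ (i + 1) : ℝ) - τ i) * rateBound Q ≤ 1) :
    IsLowerTransitionOperator (partitionOperator Q τ n) := by
  induction n with
  | zero => exact .id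
  | succ n ih =>
    refine (ih (fun i hi => hτ i (by omega)) (fun i hi => hδ i (by omega))).comp
      (hQ.eulerStep (sub_nonneg.2 ?_) (hδ n (by omega)))
    exact_mod_cast (hτ n (by omega)).le

theorem IsTransitionSemigroup.isCorresponding [DecidableEq X]
    (hQ : IsLowerTransitionRateOperator Q) (hS : IsTransitionSemigroup Q C S) (t s : ℝ≥0) :
    IsCorrespondingLowerTransitionOperator Q t s (S (s - t)) := by
  refine ⟨hS.lower _, fun ε hε => ?_⟩
  have hC := hS.nonneg
  have hK := rateBound_nonneg (Q := Q)
  have hp : 0 < rateBound Q + 1 + C * s / ε := by positivity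
  -- The first summand makes each step a lower transition operator, the last makes the total error
  -- at most `ε`, and the `1` keeps the denominator positive.
  refine ⟨1 / (rateBound Q + 1 + C * s / ε), by positivity, fun n τ hτ hδ f hf => ?_⟩
  obtain ⟨rfl, rfl, hlt⟩ := hτ
  have hP : ∀ i ≤ n, IsLowerTransitionOperator (ImpreciseCTMC.partitionOperator Q τ i) := by
    intro i hi
    refine hQ.partitionOperator i (fun j hj => hlt j (by omega)) fun j hj => ?_
    refine (mul_le_mul_of_nonneg_right (hδ j (by omega)) hK).trans ?_
    rw [one_div_mul_eq_div, div_le_one hp]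
    have : 0 ≤ C * τ n / ε := by positivity
    linarith
  refine (hS.norm_sub_partitionOperator_le n hlt hδ hP f).trans ?_
  rw [hf, mul_one, mul_one_div, div_mul_eq_mul_div, div_le_iff₀ hp]
  have h1 : C * ((τ n : ℝ) - τ 0) ≤ C * τ n :=
    mul_le_mul_of_nonneg_left (by linarith [(τ 0).coe_nonneg]) hC
  have h2 : ε * (C * τ n / ε) = C * τ n := by field_simp
  nlinarith [mul_nonneg hε.le hK]

theorem exists_isPartition {t s : ℝ≥0} (hts : t ≤ s) {δ : ℝ} (hδ : 0 < δ) :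
    ∃ (n : ℕ) (τ : ℕ → ℝ≥0), IsPartition t s n τ ∧ ∀ i < n, (τ (i + 1) : ℝ) - τ i ≤ δ := by
  rcases hts.eq_or_lt with rfl | hlt
  · exact ⟨0, fun _ => t, ⟨rfl, rfl, by simp⟩, by simp⟩
  obtain ⟨n, hn⟩ := exists_nat_gt (((s - t : ℝ≥0) : ℝ) / δ)
  have hd : 0 < s - t := tsub_pos_of_lt hlt
  have hd' : (0 : ℝ) < ((s - t : ℝ≥0) : ℝ) := hd
  have hn0 : (0 : ℝ) < n := (div_pos hd' hδ).trans hn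
  have hn0' : (n : ℝ≥0) ≠ 0 := by
    have : n ≠ 0 := by rintro rfl; simp at hn0
    exact_mod_cast this
  refine ⟨n, fun i => t + i * ((s - t) / n), ⟨by simp, ?_, fun i _ => ?_⟩, fun i _ => ?_⟩
  · simp only
    rw [mul_div_cancel₀ _ hn0', add_tsub_cancel_of_le hts]
  · push_cast
    rw [add_mul, one_mul, ← add_assoc]
    exact lt_add_of_pos_right _ (div_pos hd (pos_iff_ne_zero.2 hn0'))
  · rw [div_lt_iff₀ hδ] at hn
    push_cast
    rw [show ∀ a b c : ℝ, a + (b + 1) * c - (a + b * c) = c by intros; ring, div_le_iff₀ hn0]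
    rw [mul_comm]; exact hn.le

theorem IsCorrespondingLowerTransitionOperator.unique {t s : ℝ≥0} (hts : t ≤ s)
    {T U : (X → ℝ) → X → ℝ} (hT : IsCorrespondingLowerTransitionOperator Q t s T)
    (hU : IsCorrespondingLowerTransitionOperator Q t s U) : T = U := by
  have key : ∀ f : X → ℝ, ‖f‖ = 1 → T f = U f := by
    intro f hf
    refine eq_of_norm_sub_le_zero (le_of_forall_pos_le_add fun ε hε => ?_)
    obtain ⟨δ₁, h₁, H₁⟩ := hT.2 (ε / 2) (half_pos hε)
    obtain ⟨δ₂, h₂, H₂⟩ := hU.2 (ε / 2) (half_pos hε)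
    obtain ⟨n, τ, hτ, hm⟩ := exists_isPartition hts (lt_min h₁ h₂)
    have a := H₁ n τ hτ (fun i hi => (hm i hi).trans (min_le_left _ _)) f hf
    have b := H₂ n τ hτ (fun i hi => (hm i hi).trans (min_le_right _ _)) f hf
    rw [norm_sub_rev] at b
    linarith [norm_sub_le_norm_sub_add_norm_sub (T f) (ImpreciseCTMC.partitionOperator Q τ n f)
      (U f)]
  funext f
  by_cases hf : f = 0
  · subst hf
    exact (funext hT.1.map_zero).trans (funext hU.1.map_zero).symm
  · have hf' : ‖f‖ ≠ 0 := norm_ne_zero_iff.2 hf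
    have h1 : ‖(‖f‖⁻¹ • f)‖ = 1 := by rw [norm_smul, norm_inv, norm_norm, inv_mul_cancel₀ hf']
    have e : f = ‖f‖ • ‖f‖⁻¹ • f := by rw [smul_smul, mul_inv_cancel₀ hf', one_smul]
    ext x
    rw [e, hT.1.homogeneous _ _ _ (norm_nonneg f), hU.1.homogeneous _ _ _ (norm_nonneg f),
      key _ h1]

/-- `lowerTransitionOperator` is a bare choice; existence through `S` and uniqueness through a
common fine partition determine its value. -/
theorem IsTransitionSemigroup.lowerTransitionOperator_eq [DecidableEq X]
    (hQ : IsLowerTransitionRateOperator Q) (hS : IsTransitionSemigroup Q C S) {t s : ℝ≥0}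
    (hts : t ≤ s) : lowerTransitionOperator Q t s = S (s - t) :=
  (Classical.epsilon_spec (p := IsCorrespondingLowerTransitionOperator Q t s)
    ⟨_, hS.isCorresponding hQ t s⟩ :
    IsCorrespondingLowerTransitionOperator Q t s (lowerTransitionOperator Q t s)).unique hts
      (hS.isCorresponding hQ t s)

end Semigroup


/-! ### Dominating linear functionals -/

section Dominating

variable {X : Type*} [Fintype X] [DecidableEq X] [Nonempty X] {T : (X → ℝ) → X → ℝ}

/-- Hahn–Banach for the sublinear map `f ↦ -T (-f) x`: a linear functional below it is above `T ·
x`. On the line through `h` the functional is prescribed to have value `T h x` at `h`. -/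
theorem IsLowerTransitionOperator.exists_linearMap (hT : IsLowerTransitionOperator T) {h : X → ℝ}
    (hne : h ≠ 0) (x : X) :
    ∃ φ : (X → ℝ) →ₗ[ℝ] ℝ, (∀ f, T f x ≤ φ f) ∧ φ h = T h x := by
  have hneg : ∀ f, T f x ≤ -T (-f) x := fun f => by
    have h1 := hT.superadditive f (-f) x
    rw [add_neg_cancel, hT.map_zero] at h1
    linarith
  obtain ⟨φ, h1, h2⟩ := exists_extension_of_le_sublinear
    (LinearPMap.mkSpanSingleton h (T h x) hne) (fun f => -T (-f) x)
    (fun c hc f => by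
      have := hT.homogeneous c (-f) x hc.le
      rw [smul_neg] at this
      simp only [this]; ring)
    (fun f g => by
      have := hT.superadditive (-f) (-g) x
      rw [← neg_add] at this
      linarith)
    (by
      rintro ⟨f, hf⟩
      obtain ⟨c, rfl⟩ := Submodule.mem_span_singleton.1 hf
      have e : LinearPMap.mkSpanSingleton h (T h x) hne ⟨c • h, hf⟩ = c * T h x :=
        LinearPMap.mkSpanSingleton'_apply _ _ _ _ _
      rw [e]
      rcases le_total 0 c with hc | hc
      · rw [← hT.homogeneous c h x hc]
        exact hneg _
      · have := hT.homogeneous (-c) h x (neg_nonneg.2 hc)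
        rw [neg_smul] at this
        simp only [this]
        exact le_of_eq (by ring))
  refine ⟨φ, fun f => ?_, ?_⟩
  · have := h2 (-f)
    rw [neg_neg, map_neg] at this
    linarith
  · have := h1 ⟨h, Submodule.mem_span_singleton_self h⟩
    rw [this]
    exact (LinearPMap.mkSpanSingleton_apply ℝ ℝ hne _)

/-- A lower transition operator is the lower envelope of its dominating probability mass functions,
and the envelope is attained. -/
theorem IsLowerTransitionOperator.exists_dominating (hT : IsLowerTransitionOperator T)
    (h : X → ℝ) (x : X) :
    ∃ p : X → ℝ, (∀ y, 0 ≤ p y) ∧ ∑ y, p y = 1 ∧ (∀ f, T f x ≤ ∑ y, p y * f y) ∧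
      ∑ y, p y * h y = T h x := by
  obtain ⟨φ, h1, h2⟩ : ∃ φ : (X → ℝ) →ₗ[ℝ] ℝ, (∀ f, T f x ≤ φ f) ∧ φ h = T h x := by
    by_cases hne : h = 0
    · obtain ⟨φ, h1, -⟩ := hT.exists_linearMap (h := 1) one_ne_zero x
      exact ⟨φ, h1, by rw [hne, LinearMap.map_zero, hT.map_zero]⟩
    · exact hT.exists_linearMap hne x
  have hφ : ∀ f, φ f = ∑ y, φ (Pi.single y 1) * f y := by
    intro f
    conv_lhs => rw [← Finset.univ_sum_single f, map_sum]
    refine Finset.sum_congr rfl fun y _ => ?_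
    have : (Pi.single y (f y) : X → ℝ) = f y • Pi.single y 1 := by
      rw [← Pi.single_smul]; simp
    rw [this, map_smul, smul_eq_mul, mul_comm]
  refine ⟨fun y => φ (Pi.single y 1), fun y => ?_, ?_, fun f => hφ f ▸ h1 f, hφ h ▸ h2⟩
  · refine (hT.le_of_forall_le (fun z => ?_) x).trans (h1 _)
    by_cases hz : z = y
    · subst hz; simp
    · simp [hz]
  · have a := (hT.le_of_forall_le (f := 1) (c := 1) (fun _ => le_rfl) x).trans (h1 1)
    have b := (hT.le_of_forall_le (f := -1) (c := -1) (fun _ => le_rfl) x).trans (h1 (-1))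
    rw [map_neg] at b
    have e := hφ 1
    simp only [Pi.one_apply, mul_one] at e
    rw [← e]
    linarith

end Dominating

/-! ### Expectation functionals on finite time grids -/

section Grid

variable {X : Type*} [Fintype X] [DecidableEq X] [Nonempty X]

/-- An expectation functional on real functions of paths that has full support on the grid `v`,
whose conditional expectations dominate the semigroup `S` up to a relative error `δ`, and whose
conditional expectations of `f₀` at time `s₀` agree with `S` up to this error. -/
structure IsGridExpectation (S : ℝ≥0 → (X → ℝ) → X → ℝ) (s₀ : ℝ≥0) (f₀ : X → ℝ)
    (v : Finset ℝ≥0) (δ : ℝ) (E : ((ℝ≥0 → X) → ℝ) →ₗ[ℝ] ℝ) : Prop where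
  nonneg : ∀ F : (ℝ≥0 → X) → ℝ, (∀ ω, 0 ≤ F ω) → 0 ≤ E F
  full : ∀ ω : ℝ≥0 → X, 0 < E ({ω' | ∀ r ∈ v, ω' r = ω r}.indicator 1)
  lower : ∀ t ∈ v, ∀ s ∈ v, t ≤ s → ∀ H : (ℝ≥0 → X) → ℝ, (∀ ω, 0 ≤ H ω) →
    DependsOn H {r | r ∈ v ∧ r ≤ t} → ∀ g : X → ℝ,
      E (fun ω => H ω * (S (s - t) g (ω t) - g (ω s))) ≤ δ * ‖g‖ * E H
  attain : ∀ t ∈ v, ∀ s ∈ v, t ≤ s → s ≤ s₀ → ∀ H : (ℝ≥0 → X) → ℝ, (∀ ω, 0 ≤ H ω) →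
    DependsOn H {r | r ∈ v ∧ r ≤ t} →
      E (fun ω => H ω * (S (s₀ - s) f₀ (ω s) - S (s₀ - t) f₀ (ω t))) ≤ δ * ‖f₀‖ * E H

variable {S : ℝ≥0 → (X → ℝ) → X → ℝ} {s₀ : ℝ≥0} {f₀ : X → ℝ} {v : Finset ℝ≥0} {δ : ℝ}
  {E : ((ℝ≥0 → X) → ℝ) →ₗ[ℝ] ℝ}

theorem IsGridExpectation.mono (hE : IsGridExpectation S s₀ f₀ v δ E) {F G : (ℝ≥0 → X) → ℝ}
    (h : ∀ ω, F ω ≤ G ω) : E F ≤ E G := by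
  have := hE.nonneg (G - F) fun ω => sub_nonneg.2 (h ω)
  rw [map_sub] at this
  linarith

/-- Extend an expectation functional by sampling the state at time `b` from the kernel `k`. -/
noncomputable def extendExpectation (E : ((ℝ≥0 → X) → ℝ) →ₗ[ℝ] ℝ) (b : ℝ≥0)
    (k : (ℝ≥0 → X) → X → ℝ) :
    ((ℝ≥0 → X) → ℝ) →ₗ[ℝ] ℝ where
  toFun F := E fun ω => ∑ y, k ω y * F (Function.update ω b y)
  map_add' F G := by
    rw [← map_add]
    congr 1
    funext ω
    simp only [Pi.add_apply, mul_add, Finset.sum_add_distrib]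
  map_smul' c F := by
    rw [RingHom.id_apply, ← map_smul]
    congr 1
    funext ω
    simp only [Pi.smul_apply, smul_eq_mul, Finset.mul_sum]
    exact Finset.sum_congr rfl fun y _ => by ring

theorem extendExpectation_apply (E : ((ℝ≥0 → X) → ℝ) →ₗ[ℝ] ℝ) (b : ℝ≥0)
    (k : (ℝ≥0 → X) → X → ℝ) (F : (ℝ≥0 → X) → ℝ) :
    extendExpectation E b k F = E fun ω => ∑ y, k ω y * F (Function.update ω b y) := rfl

theorem DependsOn.apply_update {H : (ℝ≥0 → X) → ℝ} {w : Set ℝ≥0} (hH : DependsOn H w) {b : ℝ≥0}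
    (hb : b ∉ w) (ω : ℝ≥0 → X) (y : X) : H (Function.update ω b y) = H ω :=
  hH fun r hr => Function.update_of_ne (by rintro rfl; exact hb hr) _ _

theorem extendExpectation_of_dependsOn {b : ℝ≥0} {k : (ℝ≥0 → X) → X → ℝ}
    (hk : ∀ ω, ∑ y, k ω y = 1) {F : (ℝ≥0 → X) → ℝ} {w : Set ℝ≥0} (hF : DependsOn F w)
    (hb : b ∉ w) : extendExpectation E b k F = E F := by
  rw [extendExpectation_apply]
  congr 1
  funext ω
  simp only [DependsOn.apply_update hF hb, ← Finset.sum_mul, hk, one_mul]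

/-- A transition kernel with full support from the last time point of a grid `v` to a later time
point `b`. -/
theorem exists_gridKernel {Q : (X → ℝ) → X → ℝ} {C : ℝ} (hS : IsTransitionSemigroup Q C S)
    (v : Finset ℝ≥0) (b : ℝ≥0) (φ : X → ℝ) {ε : ℝ} (h0 : 0 < ε) (h1 : ε ≤ 1) :
    ∃ k : (ℝ≥0 → X) → X → ℝ, (∀ ω y, ε / Fintype.card X ≤ k ω y) ∧ (∀ ω, ∑ y, k ω y = 1) ∧
      ∀ t ∈ v, ∃ a ∈ v, t ≤ a ∧
        (∀ ω g, S (b - a) g (ω a) - 2 * ε * ‖g‖ ≤ ∑ y, k ω y * g y) ∧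
        ∀ ω, ∑ y, k ω y * φ y ≤ S (b - a) φ (ω a) + 2 * ε * ‖φ‖ := by
  have hc : (0 : ℝ) < Fintype.card X := by exact_mod_cast Fintype.card_pos
  rcases v.eq_empty_or_nonempty with rfl | hv
  · refine ⟨fun _ _ => 1 / Fintype.card X, fun _ _ => ?_, fun _ => ?_, by simp⟩
    · exact div_le_div_of_nonneg_right h1 hc.le
    · simp
  set a := v.max' hv
  choose p p0 p1 pS pφ using (hS.lower (b - a)).exists_dominating φ
  -- Noise of weight `ε` gives full support and changes the mean of `g` by at most `2 ε ‖g‖`.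
  let k : (ℝ≥0 → X) → X → ℝ := fun ω y => (1 - ε) * p (ω a) y + ε / Fintype.card X
  have hk : ∀ ω (g : X → ℝ), ∑ y, k ω y * g y =
      ∑ y, p (ω a) y * g y + ε * ((∑ y, g y) / Fintype.card X - ∑ y, p (ω a) y * g y) := by
    intro ω g
    simp only [k, add_mul, Finset.sum_add_distrib, mul_assoc, ← Finset.mul_sum]
    ring
  have hu : ∀ g : X → ℝ, |(∑ y, g y) / Fintype.card X| ≤ ‖g‖ := by
    intro g
    rw [abs_div, abs_of_pos hc, div_le_iff₀ hc]
    refine (Finset.abs_sum_le_sum_abs _ _).trans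
      ((Finset.sum_le_card_nsmul _ _ ‖g‖ fun y _ => norm_le_pi_norm g y).trans ?_)
    rw [Finset.card_univ, nsmul_eq_mul, mul_comm]
  have hp : ∀ x (g : X → ℝ), |∑ y, p x y * g y| ≤ ‖g‖ := by
    intro x g
    refine (Finset.abs_sum_le_sum_abs _ _).trans ?_
    calc ∑ y, |p x y * g y| ≤ ∑ y, p x y * ‖g‖ := Finset.sum_le_sum fun y _ => by
          rw [abs_mul, abs_of_nonneg (p0 x y)]
          exact mul_le_mul_of_nonneg_left (norm_le_pi_norm g y) (p0 x y)
      _ = ‖g‖ := by rw [← Finset.sum_mul, p1, one_mul]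
  refine ⟨k, fun ω y => ?_, fun ω => ?_, fun t ht => ⟨a, v.max'_mem hv, v.le_max' t ht, ?_, ?_⟩⟩
  · have := mul_nonneg (sub_nonneg.2 h1) (p0 (ω a) y)
    simp only [k]; linarith
  · have := hk ω 1
    simp only [Pi.one_apply, mul_one, p1] at this
    rw [this]
    simp [hc.ne']
  · intro ω g
    have := mul_le_mul_of_nonneg_left (a := ε) (add_le_add (hu g) (hp (ω a) g)) h0.le
    have h2 := mul_le_mul_of_nonneg_left
      (add_le_add (neg_abs_le ((∑ y, g y) / Fintype.card X))
        (neg_le_neg (le_abs_self (∑ y, p (ω a) y * g y)))) h0.le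
    rw [hk]
    linarith [pS (ω a) g]
  · intro ω
    have := mul_le_mul_of_nonneg_left (a := ε) (add_le_add (hu φ) (hp (ω a) φ)) h0.le
    have h2 := mul_le_mul_of_nonneg_left
      (add_le_add (le_abs_self ((∑ y, φ y) / Fintype.card X))
        (neg_le_abs (∑ y, p (ω a) y * φ y))) h0.le
    rw [hk]
    linarith [pφ (ω a)]

/-- The new state is sampled given the state at the last time `a` of the grid, from the kernel
attaining `S (b - a)` at `S (s₀ - b) f₀`. Chaining this with the old bounds between `t` and `a`
gives those between `t` and `b`, at an extra cost `2 ε`. -/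
theorem IsGridExpectation.exists_insert {Q : (X → ℝ) → X → ℝ} {C : ℝ}
    (hS : IsTransitionSemigroup Q C S) (hE : IsGridExpectation S s₀ f₀ v δ E) {b : ℝ≥0}
    (hb : ∀ r ∈ v, r < b) (hδ : 0 ≤ δ) {ε : ℝ} (h0 : 0 < ε) (h1 : ε ≤ 1) :
    ∃ E', IsGridExpectation S s₀ f₀ (insert b v) (δ + 2 * ε) E' := by
  have hbv : b ∉ v := fun h => lt_irrefl b (hb b h)
  have hc : (0 : ℝ) < Fintype.card X := by exact_mod_cast Fintype.card_pos
  obtain ⟨k, kpos, ksum, kstep⟩ := exists_gridKernel hS v b (S (s₀ - b) f₀) h0 h1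
  have k0 : ∀ ω y, 0 ≤ k ω y := fun ω y => (div_pos h0 hc).le.trans (kpos ω y)
  have hdep : ∀ {t : ℝ≥0}, t ∈ v → {r | r ∈ insert b v ∧ r ≤ t} = {r | r ∈ v ∧ r ≤ t} := by
    intro t ht
    ext r
    simp only [Set.mem_ofPred_eq, Finset.mem_insert]
    refine ⟨fun h => ⟨h.1.resolve_left fun h' => ?_, h.2⟩, fun h => ⟨Or.inr h.1, h.2⟩⟩
    exact absurd (hb t ht) (not_lt.2 (h' ▸ h.2))
  have hold : ∀ {H : (ℝ≥0 → X) → ℝ} {t s : ℝ≥0}, t ∈ v → s ∈ v →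
      DependsOn H {r | r ∈ v ∧ r ≤ t} → ∀ ψ : X → X → ℝ,
      extendExpectation E b k (fun ω => H ω * ψ (ω t) (ω s)) =
        E fun ω => H ω * ψ (ω t) (ω s) := by
    intro H t s ht hs hH ψ
    refine extendExpectation_of_dependsOn ksum (w := v) (fun ω ω' h => ?_) hbv
    simp only [hH (x := ω) (y := ω') fun r hr => h r hr.1, h t ht, h s hs]
  have hH' : ∀ {H : (ℝ≥0 → X) → ℝ} {t : ℝ≥0}, DependsOn H {r | r ∈ v ∧ r ≤ t} →
      extendExpectation E b k H = E H := fun hH =>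
    extendExpectation_of_dependsOn ksum hH fun h => hbv h.1
  -- Resampling at `b` leaves `H` and the state at `t` alone, and replaces `h (ω b)` by its mean
  -- under the kernel.
  have hnew : ∀ {H : (ℝ≥0 → X) → ℝ} {t : ℝ≥0}, t ∈ v →
      DependsOn H {r | r ∈ v ∧ r ≤ t} → ∀ g h : X → ℝ,
      extendExpectation E b k (fun ω => H ω * (g (ω t) + h (ω b))) =
        E fun ω => H ω * (g (ω t) + ∑ y, k ω y * h y) := by
    intro H t ht hH g h
    rw [extendExpectation_apply]
    congr 1
    funext ω
    simp only [DependsOn.apply_update hH fun h => hbv h.1, Function.update_self,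
      Function.update_of_ne (hb t ht).ne]
    rw [mul_add, Finset.mul_sum, ← one_mul (H ω * g (ω t)), ← ksum ω, Finset.sum_mul,
      ← Finset.sum_add_distrib]
    exact Finset.sum_congr rfl fun y _ => by ring
  have hslack : ∀ {H : (ℝ≥0 → X) → ℝ} (N : ℝ), (∀ ω, 0 ≤ H ω) → 0 ≤ N →
      δ * N * E H ≤ (δ + 2 * ε) * N * E H := fun N hH hN =>
    mul_le_mul_of_nonneg_right (mul_le_mul_of_nonneg_right (by linarith) hN) (hE.nonneg _ hH)
  have hbound : ∀ {H : (ℝ≥0 → X) → ℝ} {F G : (ℝ≥0 → X) → ℝ} {N : ℝ}, (∀ ω, 0 ≤ H ω) →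
      (∀ ω, F ω ≤ G ω + 2 * ε * N) → E (fun ω => H ω * G ω) ≤ δ * N * E H →
      E (fun ω => H ω * F ω) ≤ (δ + 2 * ε) * N * E H := by
    intro H F G N hH hFG hG
    have a : E (fun ω => H ω * F ω) ≤ E ((fun ω => H ω * G ω) + (2 * ε * N) • H) := by
      refine hE.mono fun ω => ?_
      simp only [Pi.add_apply, Pi.smul_apply, smul_eq_mul]
      nlinarith [mul_le_mul_of_nonneg_left (hFG ω) (hH ω)]
    rw [map_add, map_smul, smul_eq_mul] at a
    linarith
  refine ⟨extendExpectation E b k, ⟨fun F hF => ?_, fun ω => ?_, ?_, ?_⟩⟩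
  · exact hE.nonneg _ fun ω => Finset.sum_nonneg fun y _ => mul_nonneg (k0 ω y) (hF _)
  · have hpos := mul_pos (div_pos h0 hc) (hE.full ω)
    rw [← smul_eq_mul, ← map_smul] at hpos
    refine hpos.trans_le (hE.mono fun ω' => ?_)
    simp only [Pi.smul_apply, smul_eq_mul]
    by_cases hω : ∀ r ∈ v, ω' r = ω r
    · have hmem : Function.update ω' b (ω b) ∈ {ω' | ∀ r ∈ insert b v, ω' r = ω r} := by
        intro r hr
        rcases Finset.mem_insert.1 hr with rfl | hr
        · simp
        · rw [Function.update_of_ne (hb r hr).ne, hω r hr]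
      refine le_trans ?_ (Finset.single_le_sum (f := fun y => k ω' y *
        {ω' | ∀ r ∈ insert b v, ω' r = ω r}.indicator (1 : (ℝ≥0 → X) → ℝ)
          (Function.update ω' b y)) (fun y _ => mul_nonneg (k0 _ _)
            (Set.indicator_nonneg (fun _ _ => zero_le_one) _)) (Finset.mem_univ (ω b)))
      simp only [Set.indicator_of_mem hmem]
      rw [Set.indicator_of_mem (by exact hω)]
      simpa using kpos ω' (ω b)
    · rw [Set.indicator_of_notMem (by exact hω), mul_zero]
      exact Finset.sum_nonneg fun y _ => mul_nonneg (k0 _ _)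
        (Set.indicator_nonneg (fun _ _ => zero_le_one) _)
  · intro t ht s hs hts H hH hHd g
    rcases Finset.mem_insert.1 ht with rfl | htv
    · obtain rfl : s = t := by
        rcases Finset.mem_insert.1 hs with h | h
        · exact h
        · exact absurd (hb s h) (not_lt.2 hts)
      simp only [tsub_self, hS.zero, sub_self, mul_zero]
      have : 0 ≤ extendExpectation E s k H :=
        hE.nonneg _ fun ω => Finset.sum_nonneg fun y _ => mul_nonneg (k0 _ _) (hH _)
      rw [show (fun _ : ℝ≥0 → X => (0 : ℝ)) = 0 from rfl, map_zero]
      positivity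
    · rw [hdep htv] at hHd
      rw [hH' hHd]
      rcases Finset.mem_insert.1 hs with rfl | hsv
      · obtain ⟨a, ha, hta, ka, -⟩ := kstep t htv
        have e := hnew htv hHd (S (s - t) g) (-g)
        simp only [Pi.neg_apply, ← sub_eq_add_neg, mul_neg, Finset.sum_neg_distrib] at e
        rw [e]
        -- Split at the last old time, so that the induction hypothesis applies to `S (s - a) g`,
        -- whose norm is at most `‖g‖`.
        have e2 : S (s - t) g = S (a - t) (S (s - a) g) := by
          rw [← hS.add, add_comm, tsub_add_tsub_cancel (hb a ha).le hta]
        rw [e2]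
        refine (hbound (N := ‖g‖) (G := fun ω => S (a - t) (S (s - a) g) (ω t) - S (s - a) g (ω a))
          hH (fun ω => ?_)
          ((hE.lower t htv a ha hta H hH hHd _).trans ?_))
        · have := ka ω g
          linarith
        · exact mul_le_mul_of_nonneg_right
            (mul_le_mul_of_nonneg_left ((hS.lower _).norm_le g) hδ) (hE.nonneg _ hH)
      · rw [hold htv hsv hHd fun x y => S (s - t) g x - g y]
        exact (hE.lower t htv s hsv hts H hH hHd g).trans (hslack _ hH (norm_nonneg g))
  · intro t ht s hs hts hs₀ H hH hHd
    rcases Finset.mem_insert.1 ht with rfl | htv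
    · obtain rfl : s = t := by
        rcases Finset.mem_insert.1 hs with h | h
        · exact h
        · exact absurd (hb s h) (not_lt.2 hts)
      simp only [sub_self, mul_zero]
      have : 0 ≤ extendExpectation E s k H :=
        hE.nonneg _ fun ω => Finset.sum_nonneg fun y _ => mul_nonneg (k0 _ _) (hH _)
      rw [show (fun _ : ℝ≥0 → X => (0 : ℝ)) = 0 from rfl, map_zero]
      positivity
    · rw [hdep htv] at hHd
      rw [hH' hHd]
      rcases Finset.mem_insert.1 hs with rfl | hsv
      · obtain ⟨a, ha, hta, -, ka⟩ := kstep t htv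
        have e := hnew htv hHd (-S (s₀ - t) f₀) (S (s₀ - s) f₀)
        simp only [Pi.neg_apply, neg_add_eq_sub] at e
        rw [e]
        have e2 : S (s₀ - a) f₀ = S (s - a) (S (s₀ - s) f₀) := by
          rw [← hS.add, add_comm, tsub_add_tsub_cancel hs₀ (hb a ha).le]
        refine (hbound (N := ‖f₀‖) (G := fun ω => S (s₀ - a) f₀ (ω a) - S (s₀ - t) f₀ (ω t))
          hH (fun ω => ?_)
          (hE.attain t htv a ha hta ((hb a ha).le.trans hs₀) H hH hHd))
        have := ka ω
        have h2 := mul_le_mul_of_nonneg_left ((hS.lower (s₀ - s)).norm_le f₀)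
          (by linarith : (0 : ℝ) ≤ 2 * ε)
        rw [e2]
        linarith
      · rw [hold htv hsv hHd fun x y => S (s₀ - s) f₀ y - S (s₀ - t) f₀ x]
        exact (hE.attain t htv s hsv hts hs₀ H hH hHd).trans (hslack _ hH (norm_nonneg f₀))

/-- Times are added in increasing order. The tolerance `δ` is quantified inside the induction: half
is granted to the old grid and the rest to the new kernel. -/
theorem exists_isGridExpectation {Q : (X → ℝ) → X → ℝ} {C : ℝ}
    (hS : IsTransitionSemigroup Q C S) (s₀ : ℝ≥0) (f₀ : X → ℝ) (v : Finset ℝ≥0) :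
    ∀ δ : ℝ, 0 < δ → ∃ E, IsGridExpectation S s₀ f₀ v δ E := by
  induction v using Finset.induction_on_max with
  | empty =>
    intro δ _
    inhabit X
    refine ⟨LinearMap.proj fun _ => default, fun F hF => hF _, fun ω => ?_, by simp, by simp⟩
    simp
  | insert b v hb ih =>
    intro δ hδ
    obtain ⟨E, hE⟩ := ih (δ / 2) (half_pos hδ)
    obtain ⟨E', hE'⟩ := hE.exists_insert hS hb (half_pos hδ).le (ε := min (δ / 4) 1)
      (lt_min (by linarith) one_pos) (min_le_right _ _)
    have h4 := min_le_left (δ / 4) 1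
    have hle : δ / 2 + 2 * min (δ / 4) 1 ≤ δ := by linarith
    refine ⟨E', hE'.nonneg, hE'.full, fun t ht s hs hts H hH hHd g => ?_,
      fun t ht s hs hts hs₀ H hH hHd => ?_⟩
    · exact (hE'.lower t ht s hs hts H hH hHd g).trans (mul_le_mul_of_nonneg_right
        (mul_le_mul_of_nonneg_right hle (norm_nonneg _)) (hE'.nonneg _ hH))
    · exact (hE'.attain t ht s hs hts hs₀ H hH hHd).trans (mul_le_mul_of_nonneg_right
        (mul_le_mul_of_nonneg_right hle (norm_nonneg _)) (hE'.nonneg _ hH))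

end Grid


/-! ### Coherence of conditional probabilities and of their limits -/

section Coherence

variable {W : Type*}

/-- The conditional probability of `A` given `C` for an expectation functional `E`. -/
noncomputable def conditionalRatio (E : (W → ℝ) →ₗ[ℝ] ℝ) (A C : Set W) : ℝ :=
  E ((A ∩ C).indicator 1) / E (C.indicator 1)

theorem conditionalRatio_mem_Icc {E : (W → ℝ) →ₗ[ℝ] ℝ} (hE : ∀ F : W → ℝ, (∀ ω, 0 ≤ F ω) → 0 ≤ E F)
    (A C : Set W) : conditionalRatio E A C ∈ Icc (0 : ℝ) 1 := by
  have h0 : ∀ B : Set W, 0 ≤ E (B.indicator 1) := fun B =>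
    hE _ (Set.indicator_nonneg fun _ _ => zero_le_one)
  have h1 := hE (C.indicator 1 - (A ∩ C).indicator 1) fun ω => sub_nonneg.2
    (Set.indicator_le_indicator_of_subset inter_subset_right (fun _ => zero_le_one) ω)
  rw [map_sub] at h1
  exact ⟨div_nonneg (h0 _) (h0 _), div_le_one_of_le₀ (by linarith) (h0 _)⟩

/-- The gain of a finite combination of bets, as in the definition of coherence. -/
noncomputable def gain {n : ℕ} (l : Fin n → ℝ) (A C : Fin n → Set W) (p : Fin n → ℝ) (ω : W) : ℝ :=
  ∑ i, l i * (C i).indicator (1 : W → ℝ) ω * (p i - (A i).indicator (1 : W → ℝ) ω)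

theorem gain_congr {n : ℕ} (l : Fin n → ℝ) {A C : Fin n → Set W} (p : Fin n → ℝ) {ω ω' : W}
    (h : (fun i => (ω ∈ C i, ω ∈ A i)) = fun i => (ω' ∈ C i, ω' ∈ A i)) :
    gain l A C p ω = gain l A C p ω' := by
  classical
  refine Finset.sum_congr rfl fun i _ => ?_
  have hi := congr_fun h i
  simp only [Prod.mk.injEq, eq_iff_iff] at hi
  simp only [Set.indicator_apply, Pi.one_apply, hi.1, hi.2]

/-- The gain has expectation zero and takes finitely many values. If it were negative on the union,
with maximum `m < 0` there, it would be at most `m` on `C i₀` and at most `0` elsewhere, so its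
expectation would be negative. -/
theorem exists_gain_nonneg {E : (W → ℝ) →ₗ[ℝ] ℝ} (hE : ∀ F : W → ℝ, (∀ ω, 0 ≤ F ω) → 0 ≤ E F)
    {n : ℕ} (hn : 1 ≤ n) (l : Fin n → ℝ) (A C : Fin n → Set W)
    (hC : ∀ i, 0 < E ((C i).indicator 1)) :
    ∃ ω ∈ ⋃ i, C i, 0 ≤ gain l A C (fun i => conditionalRatio E (A i) (C i)) ω := by
  classical
  set p := fun i => conditionalRatio E (A i) (C i)
  let i₀ : Fin n := ⟨0, hn⟩
  by_contra! hneg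
  have hfin : (gain l A C p '' ⋃ i, C i).Finite := by
    refine Set.Finite.subset (Set.finite_range fun q : (Fin n → Prop × Prop) =>
      ∑ i, l i * (if (q i).1 then 1 else 0) * (p i - if (q i).2 then 1 else 0)) ?_
    rintro _ ⟨ω, -, rfl⟩
    exact ⟨fun i => (ω ∈ C i, ω ∈ A i), by simp [gain, Set.indicator_apply]⟩
  have hne : (⋃ i, C i).Nonempty := by
    obtain ⟨ω, hω⟩ : (C i₀).Nonempty := by
      rw [Set.nonempty_iff_ne_empty]
      intro h
      have := hC i₀
      rw [h, Set.indicator_empty'] at this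
      exact absurd (map_zero E) this.ne'
    exact ⟨ω, mem_iUnion.2 ⟨i₀, hω⟩⟩
  obtain ⟨ω₀, hω₀, hmax⟩ := hfin.exists_maximalFor id _ (hne.image _)
  obtain ⟨ω₁, hω₁, rfl⟩ := hω₀
  have hle : ∀ ω ∈ ⋃ i, C i, gain l A C p ω ≤ gain l A C p ω₁ := fun ω hω =>
    (le_total _ _).elim id fun h => hmax ⟨ω, hω, rfl⟩ h
  have hsum : gain l A C p = ∑ i, l i • (p i • (C i).indicator 1 - (A i ∩ C i).indicator 1) := by
    funext ω
    simp only [gain, Finset.sum_apply, Pi.smul_apply, Pi.sub_apply, smul_eq_mul]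
    refine Finset.sum_congr rfl fun i _ => ?_
    by_cases h1 : ω ∈ C i <;> by_cases h2 : ω ∈ A i <;> simp [h1, h2]
  have hzero : E (gain l A C p) = 0 := by
    rw [hsum, map_sum]
    refine Finset.sum_eq_zero fun i _ => ?_
    have : p i * E ((C i).indicator 1) = E ((A i ∩ C i).indicator 1) :=
      div_mul_cancel₀ _ (hC i).ne'
    rw [map_smul, map_sub, map_smul, smul_eq_mul, smul_eq_mul, this, sub_self, mul_zero]
  have hdom := hE (gain l A C p ω₁ • (C i₀).indicator 1 - gain l A C p) fun ω => by
    simp only [Pi.sub_apply, Pi.smul_apply, smul_eq_mul]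
    by_cases h1 : ω ∈ ⋃ i, C i
    · by_cases h2 : ω ∈ C i₀
      · simpa [h2] using hle ω h1
      · simpa [h2] using (hneg ω h1).le
    · have h2 : ∀ i, ω ∉ C i := fun i hi => h1 (mem_iUnion.2 ⟨i, hi⟩)
      simp [gain, h2]
  rw [map_sub, map_smul, hzero, sub_zero, smul_eq_mul] at hdom
  exact absurd hdom (not_le.2 (mul_neg_of_neg_of_pos (hneg ω₁ hω₁) (hC i₀)))

/-- A limit of conditional probabilities along an ultrafilter is coherent if every conditioning
event eventually has positive probability. -/
theorem isCoherent_of_tendsto {ι : Type*} {U : Ultrafilter ι} {E : ι → (W → ℝ) →ₗ[ℝ] ℝ}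
    (hE : ∀ i, ∀ F : W → ℝ, (∀ ω, 0 ≤ F ω) → 0 ≤ E i F) {D : Set (Set W × Set W)}
    (hD : ∀ q ∈ D, ∀ᶠ i in (U : Filter ι), 0 < E i (q.2.indicator 1)) {P : D → ℝ}
    (hP : ∀ q : D, Tendsto (fun i => conditionalRatio (E i) q.1.1 q.1.2) U (𝓝 (P q))) :
    IsCoherent D P := by
  intro n hn q l
  let A := fun i => (q i).1.1
  let C := fun i => (q i).1.2
  have hev : ∀ᶠ j in (U : Filter ι), ∃ π ∈ (univ : Set (Fin n → Prop × Prop)), ∃ ω ∈ ⋃ i, C i,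
      (fun i => (ω ∈ C i, ω ∈ A i)) = π ∧
        0 ≤ gain l A C (fun i => conditionalRatio (E j) (A i) (C i)) ω := by
    filter_upwards [eventually_all.2 fun i => hD _ (q i).2] with j hj
    obtain ⟨ω, hω, h⟩ := exists_gain_nonneg (hE j) hn l A C hj
    exact ⟨_, mem_univ _, ω, hω, rfl, h⟩
  -- The good outcome may vary with the index, but the gain depends only on its membership pattern;
  -- the ultrafilter selects one of the finitely many patterns.
  obtain ⟨π, -, hπ⟩ := (Ultrafilter.eventually_exists_mem_iff (Set.toFinite _)).1 hev
  obtain ⟨j, ω, hω, hωπ, -⟩ := hπ.exists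
  refine ⟨ω, hω, ?_⟩
  have hlim : Tendsto (fun j => gain l A C (fun i => conditionalRatio (E j) (A i) (C i)) ω) U
      (𝓝 (gain l A C (fun i => P (q i)) ω)) :=
    tendsto_finsetSum _ fun i _ => ((hP (q i)).sub_const _).const_mul _
  refine ge_of_tendsto hlim (hπ.mono fun j hj => ?_)
  obtain ⟨ω', -, hω', h⟩ := hj
  rwa [gain_congr l _ (hωπ.trans hω'.symm)]

end Coherence

/-! ### A process that dominates the semigroup and attains it at a given time and function -/

section Construction

variable {X : Type*} [Fintype X] [DecidableEq X] [Nonempty X] {Ω : Set (ℝ≥0 → X)}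

/-- Pulling back along `σ` turns functionals on all paths into functionals on `Ω`. Richness concerns
non-empty time sets only, hence the added time `0`. -/
theorem IsRichPathSpace.exists_section (hΩ : IsRichPathSpace Ω) (v : Finset ℝ≥0) :
    ∃ σ : (ℝ≥0 → X) → Ω, ∀ ω, ∀ r ∈ v, (σ ω).1 r = ω r := by
  have : ∀ ω : ℝ≥0 → X, ∃ ω' : Ω, ∀ r : ↥(insert 0 v), ω'.1 r = ω r := fun ω =>
    hΩ (insert 0 v) (Finset.insert_nonempty _ _) fun r => ω r
  choose σ hσ using this
  exact ⟨σ, fun ω r hr => hσ ω ⟨r, Finset.mem_insert_of_mem hr⟩⟩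

theorem StochasticProcess.prob_eq {P : StochasticProcess Ω} {A C : Set Ω}
    (h : (A, C) ∈ processDomain Ω) : P.prob A C = P.1 ⟨(A, C), h⟩ := dif_pos h

variable {S : ℝ≥0 → (X → ℝ) → X → ℝ} {s₀ : ℝ≥0} {f₀ : X → ℝ} {v : Finset ℝ≥0} {δ : ℝ}
  {E : ((ℝ≥0 → X) → ℝ) →ₗ[ℝ] ℝ} {σ : (ℝ≥0 → X) → Ω}

theorem IsGridExpectation.historyEvent_pos (hE : IsGridExpectation S s₀ f₀ v δ E)
    (hσ : ∀ ω, ∀ r ∈ v, (σ ω).1 r = ω r) {u : Finset ℝ≥0} (huv : u ⊆ v) (xu : u → X) :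
    0 < (E ∘ₗ LinearMap.funLeft ℝ ℝ σ) ((historyEvent Ω u xu).indicator 1) := by
  inhabit X
  let ω₀ : ℝ≥0 → X := fun r => if h : r ∈ u then xu ⟨r, h⟩ else default
  refine (hE.full ω₀).trans_le (hE.mono fun ω => ?_)
  refine Set.indicator_le_indicator_of_subset (s := {ω' | ∀ r ∈ v, ω' r = ω₀ r})
    (t := σ ⁻¹' historyEvent Ω u xu) (f := (1 : (ℝ≥0 → X) → ℝ)) (fun ω hω r => ?_)
    (fun _ => zero_le_one) ω
  rw [hσ ω r (huv r.2), hω r (huv r.2)]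
  simp [ω₀]

/-- The conditional expectation of `f(X_s)` under a grid expectation. -/
theorem IsGridExpectation.sum_conditionalRatio (hσ : ∀ ω, ∀ r ∈ v, (σ ω).1 r = ω r)
    {s : ℝ≥0} (hs : s ∈ v) (C : Set Ω) (f : X → ℝ) :
    ∑ y, f y * conditionalRatio (E ∘ₗ LinearMap.funLeft ℝ ℝ σ) (stateEvent Ω s y) C =
      E (fun ω => C.indicator 1 (σ ω) * f (ω s)) / E (fun ω => C.indicator 1 (σ ω)) := by
  have h : (fun ω => C.indicator 1 (σ ω) * f (ω s)) =
      ∑ y, f y • fun ω => (stateEvent Ω s y ∩ C).indicator (1 : Ω → ℝ) (σ ω) := by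
    funext ω
    simp only [Finset.sum_apply, Pi.smul_apply, smul_eq_mul]
    rw [Finset.sum_eq_single (ω s)]
    · have : σ ω ∈ stateEvent Ω s (ω s) := hσ ω s hs
      by_cases hC : σ ω ∈ C <;> simp [this, hC]
    · intro y _ hy
      have : σ ω ∉ stateEvent Ω s y := fun h => hy ((hσ ω s hs).symm.trans h).symm
      simp [this]
    · simp
  rw [h, map_sum, Finset.sum_div]
  refine Finset.sum_congr rfl fun y _ => ?_
  rw [map_smul, smul_eq_mul, mul_div_assoc]
  rfl

theorem stateEvent_inter_historyEvent {u : Finset ℝ≥0} {t : ℝ≥0} (hu : Precedes u t) (xu : u → X)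
    (x : X) : ∃ xv : ↥(insert t u) → X,
      stateEvent Ω t x ∩ historyEvent Ω u xu = historyEvent Ω (insert t u) xv := by
  have htu : t ∉ u := fun h => lt_irrefl _ (hu t h)
  refine ⟨fun r => if h : (r : ℝ≥0) ∈ u then xu ⟨r, h⟩ else x, ?_⟩
  ext ω
  simp only [stateEvent, historyEvent, Set.mem_inter_iff, Set.mem_ofPred_eq, Subtype.forall,
    Finset.mem_insert]
  constructor
  · rintro ⟨h1, h2⟩ r hr
    by_cases h : r ∈ u
    · simpa [h] using h2 r h
    · obtain rfl := hr.resolve_right h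
      simpa [h] using h1
  · intro h
    refine ⟨by simpa [htu] using h t (Or.inl rfl), fun r hr => ?_⟩
    simpa [hr] using h r (Or.inr hr)

theorem tendsto_one_div_card_add_one :
    Tendsto (fun v : Finset ℝ≥0 => 1 / ((v.card : ℝ) + 1)) atTop (𝓝 0) :=
  tendsto_one_div_add_atTop_nhds_zero_nat.comp Filter.tendsto_card_atTop_atTop

/-- The grid expectations need not be compatible with one another. Their conditional probabilities
lie in `[0, 1]`, so they converge along an ultrafilter of ever larger grids; the tolerance `1 /
(v.card + 1)` vanishes along it. -/
theorem IsTransitionSemigroup.exists_process (hΩ : IsRichPathSpace Ω) {Q : (X → ℝ) → X → ℝ}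
    {C : ℝ} (hS : IsTransitionSemigroup Q C S) (s₀ : ℝ≥0) (f₀ : X → ℝ) :
    ∃ P : StochasticProcess Ω,
      (∀ (t s : ℝ≥0), t ≤ s → ∀ (u : Finset ℝ≥0), Precedes u t → ∀ (x : X) (xu : u → X)
        (f : X → ℝ), S (s - t) f x ≤ condExpectation P u xu t x s f) ∧
      ∀ t ≤ s₀, ∀ (u : Finset ℝ≥0), Precedes u t → ∀ (x : X) (xu : u → X),
        condExpectation P u xu t x s₀ f₀ ≤ S (s₀ - t) f₀ x := by
  choose E hE using fun v : Finset ℝ≥0 => exists_isGridExpectation hS s₀ f₀ v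
    (1 / ((v.card : ℝ) + 1)) (by positivity)
  choose σ hσ using fun v : Finset ℝ≥0 => hΩ.exists_section v
  let F : Finset ℝ≥0 → (Ω → ℝ) →ₗ[ℝ] ℝ := fun v => E v ∘ₗ LinearMap.funLeft ℝ ℝ (σ v)
  have hF : ∀ v, ∀ G : Ω → ℝ, (∀ ω, 0 ≤ G ω) → 0 ≤ F v G := fun v G hG =>
    (hE v).nonneg _ fun ω => hG _
  let U : Ultrafilter (Finset ℝ≥0) := Ultrafilter.of atTop
  have hU : (U : Filter (Finset ℝ≥0)) ≤ atTop := Ultrafilter.of_le _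
  have hsub : ∀ w : Finset ℝ≥0, ∀ᶠ v in (U : Filter (Finset ℝ≥0)), w ⊆ v := fun w =>
    hU (eventually_ge_atTop w)
  have hδ : Tendsto (fun v : Finset ℝ≥0 => 1 / ((v.card : ℝ) + 1)) U (𝓝 0) :=
    tendsto_one_div_card_add_one.mono_left hU
  have hlim : ∀ q : processDomain Ω,
      ∃ p, Tendsto (fun v => conditionalRatio (F v) q.1.1 q.1.2) U (𝓝 p) := by
    intro q
    obtain ⟨p, -, hp⟩ := (isCompact_Icc (a := (0 : ℝ)) (b := 1)).ultrafilter_le_nhds'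
      (U.map fun v => conditionalRatio (F v) q.1.1 q.1.2)
      (Ultrafilter.mem_map.2 (univ_mem' fun v => conditionalRatio_mem_Icc (hF v) _ _))
    exact ⟨p, hp⟩
  choose P hP using hlim
  have hpD : ∀ q ∈ processDomain Ω, ∀ᶠ v in (U : Filter (Finset ℝ≥0)),
      0 < F v (q.2.indicator 1) := by
    rintro ⟨A, B⟩ ⟨u, xu, -, rfl⟩
    exact (hsub u).mono fun v hv => (hE v).historyEvent_pos (hσ v) hv xu
  have hcoh : IsCoherent (processDomain Ω) P := isCoherent_of_tendsto hF hpD hP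
  obtain ⟨P', hP'⟩ : ∃ P' : StochasticProcess Ω, P'.1 = P := ⟨⟨P, hcoh⟩, rfl⟩
  have hcond : ∀ (t s : ℝ≥0), t ≤ s → ∀ (u : Finset ℝ≥0), Precedes u t → ∀ (x : X) (xu : u → X)
      (f : X → ℝ), Tendsto (fun v => ∑ y, f y * conditionalRatio (F v) (stateEvent Ω s y)
        (stateEvent Ω t x ∩ historyEvent Ω u xu)) U
        (𝓝 (condExpectation P' u xu t x s f)) := by
    intro t s hts u hu x xu f
    refine tendsto_finsetSum _ fun y _ => Tendsto.const_mul _ ?_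
    have e := StochasticProcess.prob_eq (P := P') (mem_processDomain Ω hu hts xu x y)
    rw [e, hP']
    exact hP ⟨_, mem_processDomain Ω hu hts xu x y⟩
  have hdep : ∀ {v u : Finset ℝ≥0} {t : ℝ≥0}, insert t u ⊆ v → Precedes u t → ∀ (x : X)
      (xu : u → X), DependsOn (fun ω => (stateEvent Ω t x ∩ historyEvent Ω u xu).indicator
        (1 : Ω → ℝ) (σ v ω)) {r | r ∈ v ∧ r ≤ t} := by
    intro v u t huv hu x xu ω ω' h
    obtain ⟨xv, hxv⟩ := stateEvent_inter_historyEvent (Ω := Ω) hu xu x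
    have : σ v ω ∈ historyEvent Ω _ xv ↔ σ v ω' ∈ historyEvent Ω _ xv := by
      refine forall_congr' fun r => ?_
      rw [hσ v ω r (huv r.2), hσ v ω' r (huv r.2), h r ⟨huv r.2, ?_⟩]
      rcases Finset.mem_insert.1 r.2 with hr | hr
      · exact hr.le
      · exact (hu r hr).le
    simp only [hxv]
    by_cases h' : σ v ω ∈ historyEvent Ω _ xv
    · rw [Set.indicator_of_mem h', Set.indicator_of_mem (this.1 h')]
      rfl
    · rw [Set.indicator_of_notMem h', Set.indicator_of_notMem (mt this.2 h')]
  have hpos : ∀ {v u : Finset ℝ≥0} {t : ℝ≥0}, insert t u ⊆ v → Precedes u t → ∀ (x : X)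
      (xu : u → X), 0 < E v (fun ω => (stateEvent Ω t x ∩ historyEvent Ω u xu).indicator
        (1 : Ω → ℝ) (σ v ω)) := by
    intro v u t huv hu x xu
    obtain ⟨xv, hxv⟩ := stateEvent_inter_historyEvent (Ω := Ω) hu xu x
    rw [hxv]
    exact (hE v).historyEvent_pos (hσ v) huv xv
  -- On the conditioning event the state at `t` is `x`, so `g (ω t)` is a constant there.
  have hfix : ∀ {v u : Finset ℝ≥0} {t : ℝ≥0}, insert t u ⊆ v → ∀ (x : X) (xu : u → X)
      (g : X → ℝ) (G : (ℝ≥0 → X) → ℝ),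
      E v (fun ω => (stateEvent Ω t x ∩ historyEvent Ω u xu).indicator (1 : Ω → ℝ) (σ v ω) *
        (G ω - g (ω t))) =
      E v (fun ω => (stateEvent Ω t x ∩ historyEvent Ω u xu).indicator (1 : Ω → ℝ) (σ v ω) * G ω) -
      g x * E v (fun ω => (stateEvent Ω t x ∩ historyEvent Ω u xu).indicator 1 (σ v ω)) := by
    intro v u t huv x xu g G
    rw [← smul_eq_mul (g x), ← map_smul, ← map_sub]
    congr 1
    funext ω
    simp only [Pi.sub_apply, Pi.smul_apply, smul_eq_mul]
    by_cases h : σ v ω ∈ stateEvent Ω t x ∩ historyEvent Ω u xu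
    · rw [← hσ v ω t (huv (Finset.mem_insert_self _ _)), show (σ v ω).1 t = x from h.1]
      ring
    · simp [Set.indicator_of_notMem h]
  refine ⟨P', fun t s hts u hu x xu f => ?_, fun t hts u hu x xu => ?_⟩
  · have h1 := (hcond t s hts u hu x xu f).add (hδ.mul_const ‖f‖)
    rw [zero_mul, add_zero] at h1
    refine ge_of_tendsto h1 ?_
    filter_upwards [hsub (insert s (insert t u))] with v hv
    have hv' := (Finset.subset_insert s _).trans hv
    have hEH := hpos hv' hu x xu
    have := (hE v).lower t (hv' (Finset.mem_insert_self _ _)) s (hv (Finset.mem_insert_self _ _))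
      hts
      (fun ω => (stateEvent Ω t x ∩ historyEvent Ω u xu).indicator (1 : Ω → ℝ) (σ v ω))
      (fun ω => Set.indicator_nonneg (fun _ _ => zero_le_one) _) (hdep hv' hu x xu) f
    rw [IsGridExpectation.sum_conditionalRatio (hσ v) (hv (Finset.mem_insert_self _ _)),
      ← sub_le_iff_le_add, le_div_iff₀ hEH, sub_mul]
    have e := hfix hv' x xu (S (s - t) f) fun ω => f (ω s)
    rw [← neg_inj, ← map_neg] at e
    have e' : (-fun ω => (stateEvent Ω t x ∩ historyEvent Ω u xu).indicator (1 : Ω → ℝ) (σ v ω) *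
        (f (ω s) - S (s - t) f (ω t))) = fun ω => (stateEvent Ω t x ∩ historyEvent Ω u xu).indicator
          (1 : Ω → ℝ) (σ v ω) * (S (s - t) f (ω t) - f (ω s)) := by
      funext ω
      simp only [Pi.neg_apply]
      ring
    rw [← e', e] at this
    linarith
  · have h1 := (hcond t s₀ hts u hu x xu f₀).sub (hδ.mul_const ‖f₀‖)
    rw [zero_mul, sub_zero] at h1
    refine le_of_tendsto h1 ?_
    filter_upwards [hsub (insert s₀ (insert t u))] with v hv
    have hv' := (Finset.subset_insert s₀ _).trans hv
    have hEH := hpos hv' hu x xu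
    have := (hE v).attain t (hv' (Finset.mem_insert_self _ _)) s₀ (hv (Finset.mem_insert_self _ _))
      hts le_rfl
      (fun ω => (stateEvent Ω t x ∩ historyEvent Ω u xu).indicator (1 : Ω → ℝ) (σ v ω))
      (fun ω => Set.indicator_nonneg (fun _ _ => zero_le_one) _) (hdep hv' hu x xu)
    rw [IsGridExpectation.sum_conditionalRatio (hσ v) (hv (Finset.mem_insert_self _ _)),
      sub_le_iff_le_add, div_le_iff₀ hEH, add_mul]
    rw [hfix hv' x xu (S (s₀ - t) f₀) fun ω => S (s₀ - s₀) f₀ (ω s₀)] at this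
    simp only [tsub_self, hS.zero] at this
    linarith

end Construction


/-! ### Consequences of coherence -/

section Probability

variable {X : Type*} {Ω : Set (ℝ≥0 → X)} (P : StochasticProcess Ω)

theorem StochasticProcess.exists_gain_nonneg {ι : Type*} [Fintype ι] [Nonempty ι]
    (A C : ι → Set Ω) (hm : ∀ i, (A i, C i) ∈ processDomain Ω) (l : ι → ℝ) :
    ∃ ω ∈ ⋃ i, C i, 0 ≤ ∑ i, l i * (C i).indicator (1 : Ω → ℝ) ω *
      (P.prob (A i) (C i) - (A i).indicator (1 : Ω → ℝ) ω) := by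
  let e := Fintype.equivFin ι
  obtain ⟨ω, hω, h⟩ := P.2 (Fintype.card ι) Fintype.card_pos
    (fun i => ⟨(A (e.symm i), C (e.symm i)), hm _⟩) (fun i => l (e.symm i))
  obtain ⟨i, hi⟩ := mem_iUnion.1 hω
  refine ⟨ω, mem_iUnion.2 ⟨e.symm i, hi⟩, ?_⟩
  rw [← Equiv.sum_comp e.symm]
  refine h.trans_eq (Finset.sum_congr rfl fun i _ => ?_)
  have e' : P.prob (A (e.symm i)) (C (e.symm i)) = P.1 ⟨(A (e.symm i), C (e.symm i)), hm _⟩ :=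
    dif_pos _
  rw [e']

/-- Equal stakes `c` on all states make the gain a constant on `C`; the stakes `1` and `-1` force it
to vanish. The other identities below use the same device. -/
theorem StochasticProcess.sum_prob_eq_one [Fintype X] [Nonempty X] {s : ℝ≥0} {C : Set Ω}
    (hm : ∀ y, (stateEvent Ω s y, C) ∈ processDomain Ω) :
    ∑ y, P.prob (stateEvent Ω s y) C = 1 := by
  classical
  have key : ∀ c : ℝ, 0 ≤ c * (∑ y, P.prob (stateEvent Ω s y) C - 1) := by
    intro c
    obtain ⟨ω, hω, h⟩ := P.exists_gain_nonneg (fun y => stateEvent Ω s y) (fun _ => C) hm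
      fun _ => c
    obtain ⟨_, hC⟩ := mem_iUnion.1 hω
    replace hC : ω ∈ C := hC
    have h1 : ∑ y, (stateEvent Ω s y).indicator (1 : Ω → ℝ) ω = 1 := by
      simp [Set.indicator_apply, stateEvent]
    refine h.trans_eq ?_
    simp only [Set.indicator_of_mem hC, Pi.one_apply, mul_one, ← Finset.mul_sum,
      Finset.sum_sub_distrib, h1]
  linarith [key 1, key (-1)]

theorem StochasticProcess.prob_eq_of_forall {A C : Set Ω} (hm : (A, C) ∈ processDomain Ω) {c : ℝ}
    (hA : ∀ ω ∈ C, A.indicator (1 : Ω → ℝ) ω = c) : P.prob A C = c := by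
  have key : ∀ l : ℝ, 0 ≤ l * (P.prob A C - c) := by
    intro l
    obtain ⟨ω, hω, h⟩ := P.exists_gain_nonneg (fun _ : Unit => A) (fun _ => C) (fun _ => hm)
      fun _ => l
    obtain ⟨_, hC⟩ := mem_iUnion.1 hω
    replace hC : ω ∈ C := hC
    simpa [Set.indicator_of_mem hC, hA ω hC] using h
  linarith [key 1, key (-1)]

theorem mem_processDomain_historyEvent {v : Finset ℝ≥0} {s : ℝ≥0} (hs : Precedes v s)
    (xv : v → X) (y : X) : (stateEvent Ω s y, historyEvent Ω v xv) ∈ processDomain Ω :=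
  ⟨v, xv, MeasureTheory.generateSetAlgebra.base _ ⟨s, y, Or.inr hs, rfl⟩, rfl⟩

theorem Precedes.trans_le {u : Finset ℝ≥0} {t s : ℝ≥0} (hu : Precedes u t) (hts : t ≤ s) :
    Precedes u s := fun r hr => (hu r hr).trans_le hts

theorem Precedes.insert {u : Finset ℝ≥0} {t s : ℝ≥0} (hu : Precedes u t) (hts : t < s) :
    Precedes (insert t u) s := by
  intro r hr
  rcases Finset.mem_insert.1 hr with rfl | hr
  · exact hts
  · exact (hu r hr).trans hts

/-- The law of total probability. -/
theorem StochasticProcess.prob_eq_sum [Fintype X] {v : Finset ℝ≥0} {r s : ℝ≥0} (hv : Precedes v r)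
    (hrs : r ≤ s) (xv : v → X) (y : X) :
    P.prob (stateEvent Ω s y) (historyEvent Ω v xv) =
      ∑ z, P.prob (stateEvent Ω r z) (historyEvent Ω v xv) *
        P.prob (stateEvent Ω s y) (stateEvent Ω r z ∩ historyEvent Ω v xv) := by
  classical
  set A := stateEvent Ω s y
  set C := historyEvent Ω v xv
  set q := fun z => P.prob A (stateEvent Ω r z ∩ C)
  have key : ∀ c : ℝ, 0 ≤ c * (P.prob A C - ∑ z, P.prob (stateEvent Ω r z) C * q z) := by
    intro c
    -- These stakes cancel all random terms on `C`, whatever the probabilities of the conditioning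
    -- events.
    obtain ⟨ω, hω, h⟩ := P.exists_gain_nonneg (ι := Unit ⊕ X ⊕ X)
      (Sum.elim (fun _ => A) (Sum.elim (fun _ => A) fun z => stateEvent Ω r z))
      (Sum.elim (fun _ => C) (Sum.elim (fun z => stateEvent Ω r z ∩ C) fun _ => C))
      (by
        rintro (_ | z | z)
        · exact mem_processDomain_historyEvent (hv.trans_le hrs) xv y
        · exact mem_processDomain Ω hv hrs xv z y
        · exact mem_processDomain_historyEvent hv xv z)
      (Sum.elim (fun _ => c) (Sum.elim (fun _ => -c) fun z => -c * q z))
    have hC : ω ∈ C := by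
      obtain ⟨_ | z | z, hz⟩ := mem_iUnion.1 hω
      · exact hz
      · exact hz.2
      · exact hz
    have h1 : ∀ z, (stateEvent Ω r z ∩ C).indicator (1 : Ω → ℝ) ω = if z = ω.1 r then 1 else 0 := by
      intro z
      simp [Set.indicator_apply, stateEvent, hC, eq_comm]
    have h2 : ∀ z, (stateEvent Ω r z).indicator (1 : Ω → ℝ) ω = if z = ω.1 r then 1 else 0 := by
      intro z
      simp [Set.indicator_apply, stateEvent, eq_comm]
    simp only [Fintype.sum_sum_type, Sum.elim_inl, Sum.elim_inr, Finset.univ_unique,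
      Finset.sum_singleton, Set.indicator_of_mem hC, Pi.one_apply, mul_one, h1, h2, mul_ite,
      mul_zero, ite_mul, zero_mul, Finset.sum_ite_eq', Finset.mem_univ, if_true,
      mul_sub, Finset.sum_sub_distrib] at h
    refine h.trans_eq ?_
    have h3 : ∑ z, -c * q z * P.prob (stateEvent Ω r z) C =
        -(c * ∑ z, P.prob (stateEvent Ω r z) C * q z) := by
      rw [Finset.mul_sum, ← Finset.sum_neg_distrib]
      exact Finset.sum_congr rfl fun z _ => by ring
    rw [h3]
    simp only [q]
    ring
  linarith [key 1, key (-1)]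

variable [Fintype X]

theorem condExpectation_self [DecidableEq X] {u : Finset ℝ≥0} {t : ℝ≥0} (hu : Precedes u t)
    (xu : u → X) (x : X) (f : X → ℝ) : condExpectation P u xu t x t f = f x := by
  have h : ∀ y, P.prob (stateEvent Ω t y) (stateEvent Ω t x ∩ historyEvent Ω u xu) =
      if x = y then 1 else 0 := fun y =>
    P.prob_eq_of_forall (mem_processDomain Ω hu le_rfl xu x y) fun ω hω => by
      have : ω.1 t = x := hω.1
      simp [Set.indicator_apply, stateEvent, this]
  simp [condExpectation, h]

/-- The law of iterated expectations. -/
theorem sum_mul_prob_eq {v : Finset ℝ≥0} {r s : ℝ≥0} (hv : Precedes v r) (hrs : r ≤ s)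
    (xv : v → X) (f : X → ℝ) :
    ∑ y, f y * P.prob (stateEvent Ω s y) (historyEvent Ω v xv) =
      ∑ z, condExpectation P v xv r z s f * P.prob (stateEvent Ω r z) (historyEvent Ω v xv) := by
  simp only [P.prob_eq_sum hv hrs xv, condExpectation, Finset.mul_sum, Finset.sum_mul]
  rw [Finset.sum_comm]
  exact Finset.sum_congr rfl fun z _ => Finset.sum_congr rfl fun y _ => by ring

theorem transitionMatrix_mulVec (u : Finset ℝ≥0) (xu : u → X) (t s : ℝ≥0) (f : X → ℝ) (x : X) :
    (transitionMatrix P u xu t s *ᵥ f) x = condExpectation P u xu t x s f :=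
  Finset.sum_congr rfl fun _ _ => mul_comm _ _

/-- Consistency only constrains limits that are rate matrices; this shows that no limit escapes it.
The hypotheses are eventual because `t - d` is a genuine time after `u` only for small `d`. -/
theorem isRateMatrix_of_tendsto [DecidableEq X] [Nonempty X] {ι : Type*} {l : Filter ι} [l.NeBot]
    {M : ι → Matrix X X ℝ} {d : ι → ℝ≥0} {R : Matrix X X ℝ}
    (h0 : ∀ᶠ i in l, ∀ x y, 0 ≤ M i x y) (h1 : ∀ᶠ i in l, ∀ x, ∑ y, M i x y = 1)
    (hR : Tendsto (fun i => (1 / (d i : ℝ)) • (M i - 1)) l (𝓝 R)) : IsRateMatrix R := by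
  have h : ∀ x y, Tendsto (fun i => 1 / (d i : ℝ) * (M i x y - (1 : Matrix X X ℝ) x y)) l
      (𝓝 (R x y)) := fun x y => (tendsto_pi_nhds.1 (tendsto_pi_nhds.1 hR x) y)
  refine ⟨fun x => ?_, fun x y hxy => ?_⟩
  · refine tendsto_nhds_unique_of_eventuallyEq (tendsto_finsetSum _ fun y _ => h x y)
      (tendsto_const_nhds (x := (0 : ℝ))) (h1.mono fun i hi => ?_)
    change ∑ y, 1 / (d i : ℝ) * (M i x y - (1 : Matrix X X ℝ) x y) = 0
    rw [← Finset.mul_sum, Finset.sum_sub_distrib, hi x]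
    simp [Matrix.one_apply]
  · refine ge_of_tendsto (h x y) (h0.mono fun i hi => ?_)
    rw [Matrix.one_apply_ne hxy, sub_zero]
    exact mul_nonneg (by positivity) (hi x y)

theorem transitionMatrix_nonneg (u : Finset ℝ≥0) (xu : u → X) (t s : ℝ≥0) (x y : X) :
    0 ≤ transitionMatrix P u xu t s x y := (P.prob_mem_Icc _ _).1

theorem sum_transitionMatrix [Nonempty X] {u : Finset ℝ≥0} (xu : u → X) {t s : ℝ≥0}
    (hu : Precedes u t) (hts : t ≤ s) (x : X) : ∑ y, transitionMatrix P u xu t s x y = 1 :=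
  P.sum_prob_eq_one fun y => mem_processDomain Ω hu hts xu x y

theorem initialDistribution_mem_stdSimplex [Nonempty X] :
    initialDistribution P ∈ stdSimplex ℝ X :=
  ⟨fun _ => (P.prob_mem_Icc _ _).1, P.sum_prob_eq_one fun y => mem_processDomain_univ Ω 0 y⟩

theorem eventually_precedes_sub {u : Finset ℝ≥0} {t : ℝ≥0} (hu : Precedes u t) (ht : 0 < t) :
    ∀ᶠ d in 𝓝 (0 : ℝ≥0), d ≤ t ∧ Precedes u (t - d) := by
  have h : ∀ᶠ d in 𝓝 (0 : ℝ≥0), ∀ r ∈ u, d < t - r :=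
    (Finset.eventually_all u).2 fun r hr => eventually_lt_nhds (tsub_pos_of_lt (hu r hr))
  filter_upwards [h, eventually_lt_nhds ht] with d hd hdt
  refine ⟨hdt.le, fun r hr => ?_⟩
  exact lt_tsub_iff_left.2 (lt_tsub_iff_right.1 (hd r hr))

end Probability

/-! ### Processes that dominate the semigroup are well-behaved and consistent -/

section Dominated

variable {X : Type*} [Fintype X] [DecidableEq X] {Q : (X → ℝ) → X → ℝ}

/-- The matrix `M` dominates `I + d Q`, up to an error of order `d ^ 2`. -/
def DominatesUpTo (Q : (X → ℝ) → X → ℝ) (C : ℝ) (d : ℝ≥0) (M : Matrix X X ℝ) : Prop :=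
  ∀ f x, f x + d * Q f x - C * d ^ 2 * ‖f‖ ≤ (M *ᵥ f) x

/-- Domination at the indicator of `y` bounds the entry below, at its negative it bounds the entry
above; `d ≤ 1` absorbs `C * d ^ 2` into `C * d`. -/
theorem DominatesUpTo.abs_sub_le (hQ : IsLowerTransitionRateOperator Q) {C : ℝ} (hC : 0 ≤ C)
    {d : ℝ≥0} (hd : 0 < d) (hd1 : d ≤ 1) {M : Matrix X X ℝ} (hM : DominatesUpTo Q C d M) (x y : X) :
    1 / (d : ℝ) * |M x y - if y = x then 1 else 0| ≤ rateBound Q + C := by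
  have hd' : (0 : ℝ) < d := hd
  have hd1' : (d : ℝ) ≤ 1 := hd1
  have e : (Pi.single y 1 : X → ℝ) x = if y = x then 1 else 0 := by
    simp [Pi.single_apply, eq_comm]
  have hn : ‖(Pi.single y 1 : X → ℝ)‖ = 1 := by rw [Pi.norm_single, norm_one]
  have h1 := hM (Pi.single y 1) x
  have h2 := hM (-Pi.single y 1) x
  have h3 := hQ.neg_le_apply (Pi.single y 1) x
  have h4 := hQ.neg_le_apply (-Pi.single y 1) x
  rw [Matrix.mulVec_neg, Pi.neg_apply, Pi.neg_apply] at h2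
  rw [norm_neg] at h2 h4
  rw [hn, mul_one] at h1 h2 h3 h4
  rw [Matrix.mulVec_single_one, Matrix.col_apply, e] at h1 h2
  have h5 := mul_le_mul_of_nonneg_left h3 hd'.le
  have h6 := mul_le_mul_of_nonneg_left h4 hd'.le
  have h7 : C * (d : ℝ) ^ 2 ≤ d * C := by
    have := mul_le_mul_of_nonneg_left hd1' (mul_nonneg hd'.le hC)
    nlinarith
  rw [one_div_mul_eq_div, div_le_iff₀ hd', abs_le]
  constructor <;> linarith

theorem DominatesUpTo.le_of_tendsto {C : ℝ} {d : ℕ → ℝ≥0} {M : ℕ → Matrix X X ℝ}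
    {R : Matrix X X ℝ} (hd : ∀ i, 0 < d i) (hd0 : Tendsto d atTop (𝓝 0))
    (hM : ∀ᶠ i in atTop, DominatesUpTo Q C (d i) (M i))
    (hR : Tendsto (fun i => (1 / (d i : ℝ)) • (M i - 1)) atTop (𝓝 R)) (f : X → ℝ) (x : X) :
    Q f x ≤ (R *ᵥ f) x := by
  have h1 : Tendsto (fun i => (((1 / (d i : ℝ)) • (M i - 1)) *ᵥ f) x) atTop (𝓝 ((R *ᵥ f) x)) :=
    tendsto_finsetSum _ fun y _ =>
      (tendsto_pi_nhds.1 (tendsto_pi_nhds.1 hR x) y).mul_const _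
  have h2 : Tendsto (fun i => Q f x - C * (d i : ℝ) * ‖f‖) atTop (𝓝 (Q f x - C * 0 * ‖f‖)) :=
    tendsto_const_nhds.sub (((NNReal.tendsto_coe.2 hd0).const_mul C).mul_const ‖f‖)
  rw [mul_zero, zero_mul, sub_zero] at h2
  refine le_of_tendsto_of_tendsto h2 h1 (hM.mono fun i hi => ?_)
  have hdi : (0 : ℝ) < d i := hd i
  change Q f x - C * (d i : ℝ) * ‖f‖ ≤ (((1 / (d i : ℝ)) • (M i - 1)) *ᵥ f) x
  rw [Matrix.smul_mulVec, Matrix.sub_mulVec, Matrix.one_mulVec, Pi.smul_apply, Pi.sub_apply,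
    smul_eq_mul, one_div_mul_eq_div, le_div_iff₀ hdi]
  have := hi f x
  nlinarith

theorem limsup_coe_lt_top {g : ℝ≥0 → ℝ} {B : ℝ} (h : ∀ᶠ d in 𝓝[>] 0, g d ≤ B) :
    limsup (fun d => (g d : EReal)) (𝓝[>] 0) < ⊤ :=
  (limsup_le_of_le (h := h.mono fun _ hd => EReal.coe_le_coe_iff.2 hd)).trans_lt
    (EReal.coe_lt_top B)

variable [Nonempty X] {Ω : Set (ℝ≥0 → X)} {C : ℝ} {S : ℝ≥0 → (X → ℝ) → X → ℝ}

/-- A one-sided bound suffices, since it also holds for `-f`. It serves both the maximality and the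
membership of the constructed processes. -/
theorem IsTransitionSemigroup.mem_consistentProcesses (hQ : IsLowerTransitionRateOperator Q)
    (hS : IsTransitionSemigroup Q C S) {P : StochasticProcess Ω}
    (hP : ∀ (t s : ℝ≥0), t ≤ s → ∀ (u : Finset ℝ≥0), Precedes u t → ∀ (x : X) (xu : u → X)
      (f : X → ℝ), S (s - t) f x ≤ condExpectation P u xu t x s f) :
    P ∈ consistentProcesses Ω (dominatingRateMatrices Q) := by
  have hdom : ∀ (t d : ℝ≥0) (u : Finset ℝ≥0), Precedes u t → ∀ xu : u → X,
      DominatesUpTo Q C d (transitionMatrix P u xu t (t + d)) := by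
    intro t d u hu xu f x
    rw [transitionMatrix_mulVec]
    have h1 := hP t (t + d) le_self_add u hu x xu f
    rw [add_tsub_cancel_left] at h1
    have h2 := (norm_le_pi_norm _ x).trans (hS.approx d f)
    rw [Real.norm_eq_abs, abs_le] at h2
    simp only [Pi.sub_apply, Pi.add_apply, Pi.smul_apply, smul_eq_mul] at h2
    linarith [h2.1]
  have hdom' : ∀ (t : ℝ≥0) (u : Finset ℝ≥0), Precedes u t → 0 < t → ∀ xu : u → X,
      ∀ᶠ d in 𝓝 (0 : ℝ≥0), DominatesUpTo Q C d (transitionMatrix P u xu (t - d) t) ∧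
        Precedes u (t - d) := by
    intro t u hu ht xu
    filter_upwards [eventually_precedes_sub hu ht] with d hd
    have := hdom (t - d) d u hd.2 xu
    rw [tsub_add_cancel_of_le hd.1] at this
    exact ⟨this, hd.2⟩
  have hle : ∀ᶠ d in 𝓝[>] (0 : ℝ≥0), 0 < d ∧ d ≤ 1 :=
    eventually_mem_nhdsWithin.and (nhdsWithin_le_nhds (eventually_le_nhds one_pos))
  refine ⟨fun u xu x y t hu => ⟨?_, fun ht => ?_⟩, fun t u hu xu R hR => ?_,
    initialDistribution_mem_stdSimplex P⟩
  · exact limsup_coe_lt_top (hle.mono fun d hd =>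
      (hdom t d u hu xu).abs_sub_le hQ hS.nonneg hd.1 hd.2 x y)
  · refine limsup_coe_lt_top (B := rateBound Q + C) ?_
    filter_upwards [hle, nhdsWithin_le_nhds (hdom' t u hu (pos_iff_ne_zero.2 ht) xu)] with d hd hd'
    exact hd'.1.abs_sub_le hQ hS.nonneg hd.1 hd.2 x y
  · rcases hR with ⟨hR, d, hd, hd0, hlim⟩ | ⟨ht, hR, d, hd, hd0, hlim⟩
    · exact ⟨hR, DominatesUpTo.le_of_tendsto hd hd0 (.of_forall fun i => hdom t (d i) u hu xu) hlim⟩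
    · exact ⟨hR, DominatesUpTo.le_of_tendsto hd hd0
        ((hd0.eventually (hdom' t u hu ht xu)).mono fun i hi => hi.1) hlim⟩

end Dominated

/-! ### Well-behaved consistent processes dominate the semigroup -/

section Consistent

variable {X : Type*} [Fintype X] [DecidableEq X] {Q : (X → ℝ) → X → ℝ}

/-- If all limits of the difference quotients dominate `Q`, then the difference quotients eventually
dominate `Q` up to a small error, uniformly over all functions. -/
theorem eventually_le_mulVec (hQ : IsLowerTransitionRateOperator Q) {M : ℝ≥0 → Matrix X X ℝ}
    (hb : ∀ x y, limsup (fun d : ℝ≥0 =>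
      ((1 / (d : ℝ) * |M d x y - if y = x then 1 else 0| : ℝ) : EReal)) (𝓝[>] 0) < ⊤)
    (hlim : ∀ (d : ℕ → ℝ≥0) (R : Matrix X X ℝ), (∀ i, 0 < d i) → Tendsto d atTop (𝓝 0) →
      Tendsto (fun i => (1 / (d i : ℝ)) • (M (d i) - 1)) atTop (𝓝 R) →
      ∀ f x, Q f x ≤ (R *ᵥ f) x) {ε : ℝ} (hε : 0 < ε) :
    ∀ᶠ d in 𝓝[>] (0 : ℝ≥0), ∀ x f, f x + d * (Q f x - ε * ‖f‖) ≤ (M d *ᵥ f) x := by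
  have hb' : ∀ x y, ∃ B : ℝ, ∀ᶠ d : ℝ≥0 in 𝓝[>] 0,
      1 / (d : ℝ) * |M d x y - if y = x then 1 else 0| < B := by
    intro x y
    obtain ⟨B, hB, -⟩ := EReal.lt_iff_exists_real_btwn.1 (hb x y)
    exact ⟨B, (eventually_lt_of_limsup_lt hB).mono fun d hd => EReal.coe_lt_coe_iff.1 hd⟩
  choose B hB using hb'
  refine eventually_all.2 fun x => ?_
  -- Otherwise there are `d i → 0` and `g i` of norm one violating the bound. Well-behavedness
  -- bounds the quotients, so a subsequence of quotients and functions converges to some `(R, h)`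
  -- with `R h ≤ Q h - ε` at `x`, contradicting that `R` dominates `Q`.
  by_contra hcon
  have hfr := (not_eventually.1 hcon).and_eventually
    ((eventually_all.2 fun x => eventually_all.2 fun y => hB x y).and
      (eventually_mem_nhdsWithin (a := (0 : ℝ≥0)) (s := Ioi 0)))
  obtain ⟨d, hd, hbad⟩ := exists_seq_forall_of_frequently hfr
  have hpos : ∀ i, 0 < d i := fun i => (hbad i).2.2
  have hpos' : ∀ i, (0 : ℝ) < d i := hpos
  have hd0 : Tendsto d atTop (𝓝 0) := hd.mono_right nhdsWithin_le_nhds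
  have hg : ∀ i, ∃ g : X → ℝ, ‖g‖ = 1 ∧
      (((1 / (d i : ℝ)) • (M (d i) - 1)) *ᵥ g) x ≤ Q g x - ε := by
    intro i
    have h := (hbad i).1
    push Not at h
    obtain ⟨f, hf⟩ := h
    have hf0 : f ≠ 0 := by
      rintro rfl
      simp [hQ.map_zero] at hf
    have hn : 0 < ‖f‖ := norm_pos_iff.2 hf0
    refine ⟨‖f‖⁻¹ • f, by rw [norm_smul, norm_inv, norm_norm, inv_mul_cancel₀ hn.ne'], ?_⟩
    rw [Matrix.mulVec_smul, hQ.homogeneous _ _ _ (inv_nonneg.2 hn.le), Matrix.smul_mulVec,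
      Matrix.sub_mulVec, Matrix.one_mulVec]
    simp only [Pi.smul_apply, Pi.sub_apply, smul_eq_mul]
    have h1 : 1 / (d i : ℝ) * ((M (d i) *ᵥ f) x - f x) ≤ Q f x - ε * ‖f‖ := by
      rw [one_div_mul_eq_div, div_le_iff₀ (hpos' i)]
      linarith
    have h2 := mul_le_mul_of_nonneg_left h1 (inv_nonneg.2 hn.le)
    have h3 : ‖f‖⁻¹ * (Q f x - ε * ‖f‖) = ‖f‖⁻¹ * Q f x - ε := by field_simp
    linarith
  choose g hg1 hg2 using hg
  let q : ℕ → X → X → ℝ := fun i => ((1 / (d i : ℝ)) • (M (d i) - 1) : Matrix X X ℝ)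
  have hK : IsCompact ((Set.univ.pi fun x => Set.univ.pi fun y => Icc (-B x y) (B x y)) ×ˢ
      Metric.sphere (0 : X → ℝ) 1) :=
    (isCompact_univ_pi fun x => isCompact_univ_pi fun y => isCompact_Icc).prod
      (isCompact_sphere _ _)
  obtain ⟨⟨R, h⟩, ⟨-, hh⟩, φ, hφ, hconv⟩ := hK.tendsto_subseq (x := fun i => (q i, g i)) fun i => by
    refine ⟨fun a _ b _ => abs_le.1 ?_, by simpa using hg1 i⟩
    refine le_of_eq_of_le ?_ ((hbad i).2.1 a b).le
    simp only [q, Matrix.smul_apply, Matrix.sub_apply, smul_eq_mul, Matrix.one_apply, abs_mul,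
      abs_of_pos (one_div_pos.2 (hpos' i)), eq_comm]
  rw [nhds_prod_eq] at hconv
  have hq : Tendsto (fun i => q (φ i)) atTop (𝓝 R) := tendsto_fst.comp hconv
  have hgh : Tendsto (fun i => g (φ i)) atTop (𝓝 h) := tendsto_snd.comp hconv
  have hRQ := hlim (d ∘ φ) R (fun i => hpos _) (hd0.comp hφ.tendsto_atTop) hq h x
  have h1 : Tendsto (fun i => (((1 / (d (φ i) : ℝ)) • (M (d (φ i)) - 1)) *ᵥ g (φ i)) x) atTop
      (𝓝 ((Matrix.of R *ᵥ h) x)) :=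
    tendsto_finsetSum _ fun y _ => (tendsto_pi_nhds.1 (tendsto_pi_nhds.1 hq x) y).mul
      (tendsto_pi_nhds.1 hgh y)
  have h2 : Tendsto (fun i => Q (g (φ i)) x - ε) atTop (𝓝 (Q h x - ε)) :=
    (tendsto_pi_nhds.1 ((hQ.continuous.tendsto h).comp hgh) x).sub_const ε
  have h3 := le_of_tendsto_of_tendsto' h1 h2 fun i => hg2 (φ i)
  have h4 : Q h x ≤ (Matrix.of R *ᵥ h) x := hRQ
  linarith

/-- A function that locally grows to the right and to the left of every point of an interval takes a
larger value at the right end point than at the left one. -/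
theorem le_of_eventually_le {F : ℝ≥0 → ℝ} {t s : ℝ≥0} (hts : t ≤ s)
    (hright : ∀ r, t ≤ r → r < s → ∀ᶠ d in 𝓝[>] (0 : ℝ≥0), F r ≤ F (r + d))
    (hleft : ∀ r, t < r → r ≤ s → ∀ᶠ d in 𝓝[>] (0 : ℝ≥0), F (r - d) ≤ F r) : F t ≤ F s := by
  set A := {r | t ≤ r ∧ r ≤ s ∧ F t ≤ F r}
  have htA : t ∈ A := ⟨le_rfl, hts, le_rfl⟩
  have hbdd : BddAbove A := ⟨s, fun r hr => hr.2.1⟩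
  set c := sSup A
  have htc : t ≤ c := le_csSup hbdd htA
  have hcs : c ≤ s := csSup_le ⟨t, htA⟩ fun r hr => hr.2.1
  -- Growth from the left puts the supremum in `A`, and growth from the right then forces it to be
  -- `s`; `F` need not be continuous.
  have hcA : c ∈ A := by
    by_contra hc
    have htc' : t < c := lt_of_le_of_ne htc fun h => hc (h ▸ htA)
    have hsub : Tendsto (fun r => c - r) (𝓝 c) (𝓝 0) := by
      simpa using (continuous_const.sub continuous_id).tendsto (f := fun r => c - r) c
    have hev := hsub.eventually (eventually_nhdsWithin_iff.1 (hleft c htc' hcs))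
    obtain ⟨l, hlc, hl⟩ := exists_Ioc_subset_of_mem_nhds hev ⟨t, htc'⟩
    obtain ⟨r, hr, hlr⟩ := exists_lt_of_lt_csSup ⟨t, htA⟩ hlc
    have hrc : r < c := lt_of_le_of_ne (le_csSup hbdd hr) fun h => hc (h ▸ hr)
    have h : F (c - (c - r)) ≤ F c := hl ⟨hlr, hrc.le⟩ (tsub_pos_of_lt hrc)
    rw [tsub_tsub_cancel_of_le hrc.le] at h
    exact hc ⟨htc, hcs, hr.2.2.trans h⟩
  rcases hcs.eq_or_lt with h | h
  · exact h ▸ hcA.2.2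
  · obtain ⟨d, hd, hd0, hds⟩ := ((hright c htc h).and (eventually_mem_nhdsWithin.and
      (nhdsWithin_le_nhds (eventually_lt_nhds (tsub_pos_of_lt h))))).exists
    have hmem : c + d ∈ A := ⟨htc.trans le_self_add, (lt_tsub_iff_left.1 hds).le,
      hcA.2.2.trans hd⟩
    exact absurd (le_csSup hbdd hmem) (not_le.2 (lt_add_of_pos_right c hd0))

variable [Nonempty X] {Ω : Set (ℝ≥0 → X)} {C : ℝ} {S : ℝ≥0 → (X → ℝ) → X → ℝ}
  {P : StochasticProcess Ω}

/-- A matrix that dominates `I + d Q` up to an error that is small with respect to `d` also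
dominates the semigroup, up to such an error. -/
theorem IsTransitionSemigroup.eventually_sub_le (hS : IsTransitionSemigroup Q C S)
    {M : ℝ≥0 → Matrix X X ℝ} (hM : ∀ ε : ℝ, 0 < ε → ∀ᶠ d in 𝓝[>] (0 : ℝ≥0), ∀ x f,
      f x + d * (Q f x - ε * ‖f‖) ≤ (M d *ᵥ f) x) {ε : ℝ} (hε : 0 < ε) :
    ∀ᶠ d in 𝓝[>] (0 : ℝ≥0), ∀ x f, S d f x - ε * ‖f‖ * d ≤ (M d *ᵥ f) x := by
  have hC := hS.nonneg
  have hsmall : ∀ᶠ d : ℝ≥0 in 𝓝[>] 0, C * (d : ℝ) < ε / 2 := by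
    have : Tendsto (fun d : ℝ≥0 => C * (d : ℝ)) (𝓝 0) (𝓝 (C * ((0 : ℝ≥0) : ℝ))) :=
      (NNReal.continuous_coe.tendsto 0).const_mul C
    rw [NNReal.coe_zero, mul_zero] at this
    exact nhdsWithin_le_nhds (this.eventually_lt_const (half_pos hε))
  filter_upwards [hM (ε / 2) (half_pos hε), hsmall] with d h1 h2 x f
  have h3 := (norm_le_pi_norm _ x).trans (hS.approx d f)
  rw [Real.norm_eq_abs, abs_le] at h3
  simp only [Pi.sub_apply, Pi.add_apply, Pi.smul_apply, smul_eq_mul] at h3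
  have h4 := h1 x f
  have h5 := mul_le_mul_of_nonneg_right h2.le (mul_nonneg d.coe_nonneg (norm_nonneg f))
  nlinarith [h3.2]

theorem IsTransitionSemigroup.eventually_condExpectation_right
    (hQ : IsLowerTransitionRateOperator Q) (hS : IsTransitionSemigroup Q C S)
    (hP : P ∈ consistentProcesses Ω (dominatingRateMatrices Q)) {u : Finset ℝ≥0} (xu : u → X)
    {t : ℝ≥0} (hu : Precedes u t) {ε : ℝ} (hε : 0 < ε) :
    ∀ᶠ d in 𝓝[>] (0 : ℝ≥0), ∀ x f,
      S d f x - ε * ‖f‖ * d ≤ condExpectation P u xu t x (t + d) f := by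
  obtain ⟨hw, hc, -⟩ := hP
  simp only [← transitionMatrix_mulVec]
  refine hS.eventually_sub_le (M := fun d => transitionMatrix P u xu t (t + d)) (fun ε hε => ?_) hε
  refine eventually_le_mulVec hQ (fun x y => (hw u xu x y t hu).1) (fun d R hd hd0 hR => ?_) hε
  refine (hc t u hu xu (Or.inl ⟨isRateMatrix_of_tendsto (.of_forall fun i => ?_)
    (.of_forall fun i => ?_) hR, d, hd, hd0, hR⟩)).2
  · exact transitionMatrix_nonneg P u xu t (t + d i)
  · exact sum_transitionMatrix P xu hu le_self_add

theorem IsTransitionSemigroup.eventually_condExpectation_left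
    (hQ : IsLowerTransitionRateOperator Q) (hS : IsTransitionSemigroup Q C S)
    (hP : P ∈ consistentProcesses Ω (dominatingRateMatrices Q)) {u : Finset ℝ≥0} (xu : u → X)
    {t : ℝ≥0} (hu : Precedes u t) (ht : 0 < t) {ε : ℝ} (hε : 0 < ε) :
    ∀ᶠ d in 𝓝[>] (0 : ℝ≥0), ∀ x f,
      S d f x - ε * ‖f‖ * d ≤ condExpectation P u xu (t - d) x t f := by
  obtain ⟨hw, hc, -⟩ := hP
  simp only [← transitionMatrix_mulVec]
  refine hS.eventually_sub_le (M := fun d => transitionMatrix P u xu (t - d) t) (fun ε hε => ?_) hε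
  refine eventually_le_mulVec hQ (fun x y => (hw u xu x y t hu).2 ht.ne') (fun d R hd hd0 hR => ?_)
    hε
  refine (hc t u hu xu (Or.inr ⟨ht, isRateMatrix_of_tendsto (.of_forall fun i => ?_)
    ((hd0.eventually (eventually_precedes_sub hu ht)).mono fun i hi => ?_) hR, d, hd, hd0, hR⟩)).2
  · exact transitionMatrix_nonneg P u xu (t - d i) t
  · exact sum_transitionMatrix P xu hi.2 tsub_le_self

/-- `G r` interpolates between the two sides. For `r > t` its local growth comes from iterated
expectations and the transition bounds for the history extended by `X_t = x`. -/
theorem IsTransitionSemigroup.le_condExpectation (hQ : IsLowerTransitionRateOperator Q)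
    (hS : IsTransitionSemigroup Q C S)
    (hP : P ∈ consistentProcesses Ω (dominatingRateMatrices Q)) {t s : ℝ≥0} (hts : t ≤ s)
    {u : Finset ℝ≥0} (hu : Precedes u t) (x : X) (xu : u → X) (f : X → ℝ) :
    S (s - t) f x ≤ condExpectation P u xu t x s f := by
  obtain ⟨xv, hxv⟩ := stateEvent_inter_historyEvent (Ω := Ω) hu xu x
  let G : ℝ≥0 → ℝ := fun r => condExpectation P u xu t x r (S (s - r) f)
  have hG : ∀ r, G r = ∑ z, S (s - r) f z *
      P.prob (stateEvent Ω r z) (historyEvent Ω (insert t u) xv) := fun r => by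
    simp only [G, condExpectation, hxv]
  have hnorm : ∀ r, ‖S (s - r) f‖ ≤ ‖f‖ := fun r => (hS.lower _).norm_le f
  have hstep : ∀ {r d : ℝ≥0}, t < r → r + d ≤ s → ∀ {ε : ℝ}, 0 < ε →
      (∀ z g, S d g z - ε * ‖g‖ * d ≤ condExpectation P (insert t u) xv r z (r + d) g) →
      G r - ε * ‖f‖ * d ≤ G (r + d) := by
    intro r d htr hrd ε hε h
    have hsum : ∑ z, P.prob (stateEvent Ω r z) (historyEvent Ω (insert t u) xv) = 1 :=
      P.sum_prob_eq_one fun z => mem_processDomain_historyEvent (hu.insert htr) xv z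
    have e : S (s - r) f = S d (S (s - (r + d)) f) := by
      rw [← hS.add, ← tsub_tsub, add_tsub_cancel_of_le (le_tsub_of_add_le_left hrd)]
    rw [hG, hG, sum_mul_prob_eq P (hu.insert htr) le_self_add xv]
    calc _ = ∑ z, (S d (S (s - (r + d)) f) z - ε * ‖f‖ * d) *
          P.prob (stateEvent Ω r z) (historyEvent Ω (insert t u) xv) := by
          simp only [sub_mul, Finset.sum_sub_distrib, ← Finset.mul_sum, hsum, e, mul_one]
      _ ≤ _ := by
          refine Finset.sum_le_sum fun z _ =>
            mul_le_mul_of_nonneg_right (le_trans ?_ (h z _)) (P.prob_mem_Icc _ _).1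
          have := mul_le_mul_of_nonneg_left (hnorm (r + d)) (mul_nonneg hε.le d.coe_nonneg)
          linarith
  -- The term linear in `r` compensates for the local loss `ε * ‖f‖ * d`.
  have hmain : ∀ ε : ℝ, 0 < ε → G t + ε * ‖f‖ * t ≤ G s + ε * ‖f‖ * s := by
    intro ε hε
    refine le_of_eventually_le (F := fun r => G r + ε * ‖f‖ * r) hts (fun r htr hrs => ?_)
      fun r htr hrs => ?_
    · have hsmall : ∀ᶠ d in 𝓝[>] (0 : ℝ≥0), r + d ≤ s :=
        ((eventually_lt_nhds (tsub_pos_of_lt hrs)).filter_mono nhdsWithin_le_nhds).mono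
          fun d hd => (lt_tsub_iff_left.1 hd).le
      -- At `r = t` the state is already fixed, so the transition bound for the original history
      -- applies directly.
      rcases htr.eq_or_lt with rfl | htr
      · filter_upwards [hS.eventually_condExpectation_right hQ hP xu hu hε, hsmall] with d hd hds
        have h1 := hd x (S (s - (t + d)) f)
        have e : S (s - t) f = S d (S (s - (t + d)) f) := by
          rw [← hS.add, ← tsub_tsub, add_tsub_cancel_of_le (le_tsub_of_add_le_left hds)]
        rw [← e] at h1
        have h2 : G t = S (s - t) f x := condExpectation_self P hu xu x _
        have h3 := mul_le_mul_of_nonneg_left (hnorm (t + d)) (mul_nonneg hε.le d.coe_nonneg)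
        have h4 : G (t + d) = condExpectation P u xu t x (t + d) (S (s - (t + d)) f) := rfl
        push_cast
        linarith
      · filter_upwards [hS.eventually_condExpectation_right hQ hP xv (hu.insert htr) hε, hsmall]
          with d hd hds
        have := hstep htr hds hε hd
        push_cast
        linarith
    · filter_upwards [hS.eventually_condExpectation_left hQ hP xv (hu.insert htr)
        (bot_le.trans_lt htr) hε, nhdsWithin_le_nhds (eventually_precedes_sub (hu.insert htr)
        (bot_le.trans_lt htr))] with d hd hdr
      have e := tsub_add_cancel_of_le hdr.1
      have h1 := hstep (r := r - d) (d := d) (hdr.2 t (Finset.mem_insert_self t u))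
        (e.le.trans hrs) hε (by rw [e]; exact hd)
      rw [e] at h1
      have h2 : ((r - d : ℝ≥0) : ℝ) = r - d := NNReal.coe_sub hdr.1
      rw [h2]
      linarith
  have ht : G t = S (s - t) f x := condExpectation_self P hu xu x _
  have hs : G s = condExpectation P u xu t x s f := by simp only [G, tsub_self, hS.zero]
  rw [← ht, ← hs]
  refine le_of_forall_pos_le_add fun η hη => ?_
  have hp : 0 < ‖f‖ * s + 1 := by positivity
  have h1 := hmain (η / (‖f‖ * s + 1)) (div_pos hη hp)
  have h2 : η / (‖f‖ * s + 1) * (‖f‖ * s) ≤ η := by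
    rw [div_mul_eq_mul_div, div_le_iff₀ hp]
    nlinarith
  have h3 : 0 ≤ η / (‖f‖ * s + 1) * ‖f‖ * t := by positivity
  linarith

end Consistent

end ImpreciseCTMC

/-! ### The lower envelope and its maximality -/

theorem mainTheorem10 {X : Type*} [Fintype X] [DecidableEq X] [Nonempty X]
    (Ω : Set (ℝ≥0 → X)) (hΩ : IsRichPathSpace Ω)
    (Q : (X → ℝ) → (X → ℝ)) (hQ : IsLowerTransitionRateOperator Q) :
    (∀ t s : ℝ≥0, t ≤ s →
      IsCorrespondingLowerTransitionOperator Q t s (lowerTransitionOperator Q t s)) ∧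
    IsGreatest
      {𝓢 : Set (StochasticProcess Ω) | 𝓢.Nonempty ∧
        ∀ (t s : ℝ≥0), t ≤ s → ∀ (u : Finset ℝ≥0), Precedes u t →
          ∀ (xt : X) (xu : u → X) (f : X → ℝ),
            lowerExpectation 𝓢 u xu t xt s f = lowerTransitionOperator Q t s f xt}
      (consistentProcesses Ω (dominatingRateMatrices Q)) := by
  obtain ⟨S, hS⟩ := hQ.exists_semigroup
  refine ⟨fun t s hts => ?_, ⟨?_, fun t s hts u hu xt xu f => ?_⟩, ?_⟩
  · rw [hS.lowerTransitionOperator_eq hQ hts]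
    exact hS.isCorresponding hQ t s
  · obtain ⟨P, hP, -⟩ := hS.exists_process hΩ 0 0
    exact ⟨P, hS.mem_consistentProcesses hQ hP⟩
  · rw [hS.lowerTransitionOperator_eq hQ hts]
    -- The attaining process depends on `s` and `f` only, and makes the infimum a minimum.
    obtain ⟨P, hP, hP'⟩ := hS.exists_process hΩ s f
    have hmem := hS.mem_consistentProcesses hQ hP
    refine IsLeast.csInf_eq ⟨⟨P, hmem, ?_⟩, ?_⟩
    · exact le_antisymm (hP t s hts u hu xt xu f) (hP' t hts u hu xt xu)
    · rintro _ ⟨P, hP, rfl⟩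
      exact hS.le_condExpectation hQ hP hts hu xt xu f
  · rintro 𝓢 ⟨hne, h𝓢⟩ P hP
    refine hS.mem_consistentProcesses hQ fun t s hts u hu x xu f => ?_
    rw [← hS.lowerTransitionOperator_eq hQ hts, ← h𝓢 t s hts u hu x xu f]
    exact (isGLB_lowerExpectation hne u xu t x s f).1 ⟨P, hP, rfl⟩
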